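/- \textbf{Setting.} Let $\mathcal X$ be a finite-dimensional Euclidean space, and let $\mathcal H$ be a linear subspace of the self-adjoint operators on $\mathcal X$ such that (i) $I\in\mathcal H$; (ii) $HFH\in\mathcal H$ for all $H,F\in\mathcal H$; (iii) the orthogonal projection $\mathrm{proj}_{\mathcal H}$ onto $\mathcal H$ (for the trace inner product $\langle A,B\rangle=\mathrm{tr}(A^*B)$) maps positive definite operators to positive definite operators. For $x\in\mathcal X$ put $$\mathcal R(x)=\Big\|\sqrt{\mathrm{proj}_{\mathcal H}(x\langle x,\cdot\rangle)}\Big\|_{\mathrm{op}},\qquad \mathcal R_*(x)=\mathrm{tr}\sqrt{\mathrm{proj}_{\mathcal H}(x\langle x,\cdot\rangle)} .$$ Write $\|v\|_A^2=\langle v,Av\rangle$. Let $L,\Sigma\in\mathcal H$ be positive definite. Let $f:\mathcal X\to\mathbb R$ be continuously differentiable with $$|f(x)-f(x')-\langle\nabla f(x'),x-x'\rangle|\le\tfrac12\|x-x'\|_L^2\quad\text{for all }x,x'\in\mathcal X,$$ and let $g(x;\xi)$, with $\xi$ drawn from a probability distribution $\mu$, be a (jointly measurable) stochastic gradient with $$\mathbb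 E_{\xi\sim\mu}\,g(x;\xi)=\nabla f(x),\qquad \mathbb E_{\xi\sim\mu}\|g(x;\xi)-\nabla f(x)\|_{\Sigma^{-1}}^2\le\mathrm{tr}(\Sigma)\quad\text{for all }x\in\mathcal X .$$ Let $D\in(0,+\infty]$, $Q=\{x:\mathcal R(x)\le D\}$, $f^*=\inf_{Q}f$ (if $D=+\infty$, assume that $f$ is bounded below), $x_0\in Q$, $\Delta_0=f(x_0)-f^*$, $\varepsilon>0$, and $$\mathrm{gap}_D(x)=\begin{cases}\frac1D\max_{\mathcal R(x')\le D}\langle\nabla f(x),x-x'\rangle,& D<+\infty,\\ \mathcal R_*(\nabla f(x)),& D=+\infty.\end{cases}$$ \textbf{Algorithm} (parameters $\alpha,\beta,\eta$). Draw $\xi_0\sim\mu$ and set $m_0=g(x_0;\xi_0)$. For $k=0,\dots,K-1$: let $x_{k+1}$ be a minimizer of $x\mapsto\langle m_k,x-x_k\rangle$ subject to $\mathcal R(x-(1-\beta)x_k)\le\eta$ (measurably selected, by any rule that may use the past and independent randomness); then draw $\xi_{k+1}\sim\mu$ independently of the past and set $m_{k+1}=(1-\alpha)m_k+\alpha\,g(x_{k+1};\xi_{k+1})$.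 \textbf{Theorem.} There are universal constants $a_1,b_1,C_1,a_2,b_2,C_2>0$ such that in every such setting the following holds. \emph{Non-convex case.} Let $$\alpha=\min\Big\{1,\,a_1\frac{\varepsilon^2}{\mathrm{tr}(\Sigma)^2}\Big\},\qquad \beta=\min\Big\{1,\,b_1\frac{\varepsilon\alpha}{\mathrm{tr}(L)\,D}\Big\},\qquad \eta=\beta D,$$ where for $D=+\infty$ the last two are read as $\beta=0$, $\eta=b_1\varepsilon\alpha/\mathrm{tr}(L)$. If $$K\ge C_1\max\Big\{1,\ \frac{\Delta_0}{\varepsilon D},\ \frac{\mathrm{tr}(L)\Delta_0}{\varepsilon^2},\ \frac{\mathrm{tr}(\Sigma)^3}{\varepsilon^3},\ \frac{\mathrm{tr}(\Sigma)^2\,\mathrm{tr}(L)\,\Delta_0}{\varepsilon^4}\Big\},$$ then $\mathbb E\big[\min_{0\le k\le K-1}\mathrm{gap}_D(x_k)\big]\le\varepsilon$. \emph{Convex case.} If in addition $f$ is convex and $D<+\infty$, let $$\alpha=\min\Big\{1,\,a_2\frac{\varepsilon^2}{\mathrm{tr}(\Sigma)^2D^2}\Big\},\qquad \beta=\min\Big\{\alpha,\,b_2\frac{\varepsilon\alpha}{\mathrm{tr}(L)\,D^2}\Big\},\qquad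 \eta=\beta D.$$ If $$K\ge C_2\max\Big\{1,\ \frac{\mathrm{tr}(L)D^2}{\varepsilon},\ \frac{\mathrm{tr}(\Sigma)^2D^2}{\varepsilon^2},\ \frac{\mathrm{tr}(\Sigma)^2\,\mathrm{tr}(L)\,D^4}{\varepsilon^3}\Big\}\cdot\Big(1+\log\Big(1+\frac{\Delta_0}{\varepsilon}+\frac{\mathrm{tr}(\Sigma)D}{\varepsilon}\Big)\Big),$$ then $\mathbb E[f(x_K)-f^*]\le\varepsilon$. -/

import Mathlib

open MeasureTheory ProbabilityTheory
open scoped ENNReal InnerProductSpace Gradient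

set_option linter.unusedSectionVars false

noncomputable section

namespace NonEuclideanSGD

variable {X : Type*} [NormedAddCommGroup X] [InnerProductSpace ℝ X] [FiniteDimensional ℝ X]
  [CompleteSpace X]

/-! ### Operators on a finite-dimensional Euclidean space -/

/-- The trace of an operator. On positive semidefinite operators it is the nuclear norm. -/
def opTrace (A : X →L[ℝ] X) : ℝ := LinearMap.trace ℝ X (A : X →ₗ[ℝ] X)

/-- Self-adjoint positive definite operators. -/
def PosDef (A : X →L[ℝ] X) : Prop :=
  IsSelfAdjoint A ∧ ∀ v : X, v ≠ 0 → 0 < ⟪v, A v⟫_ℝ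

/-- The weighted squared norm `‖v‖²_A = ⟪v, A v⟫`. -/
def wnormSq (A : X →L[ℝ] X) (v : X) : ℝ := ⟪v, A v⟫_ℝ

/-- The Frobenius (trace) inner product `⟨A, B⟩ = tr (A† B)` of operators. -/
def frob (A B : X →L[ℝ] X) : ℝ := opTrace (star A * B)

/-- `S` is a positive semidefinite square root of `A`. -/
def IsPosSqrt (A S : X →L[ℝ] X) : Prop := S.IsPositive ∧ S * S = A

/-- `P` is the orthogonal projection of `A` onto `H` for the Frobenius inner product. -/
def IsFrobProj (H : Submodule ℝ (X →L[ℝ] X)) (A P : X →L[ℝ] X) : Prop :=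
  P ∈ H ∧ ∀ F ∈ H, frob F (A - P) = 0

theorem PosDef.isUnit {A : X →L[ℝ] X} (hA : PosDef A) : IsUnit A := by
  have hker : LinearMap.ker (A : X →ₗ[ℝ] X) = ⊥ := by
    rw [LinearMap.ker_eq_bot']
    intro v hv
    by_contra h
    have h1 := hA.2 v h
    have h2 : A v = 0 := hv
    rw [h2, inner_zero_right] at h1
    exact lt_irrefl _ h1
  let e : X ≃ₗ[ℝ] X := LinearEquiv.ofInjectiveEndo (A : X →ₗ[ℝ] X) (LinearMap.ker_eq_bot.1 hker)
  let e' : X ≃L[ℝ] X := e.toContinuousLinearEquiv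
  have h : (e' : X →L[ℝ] X) = A := by
    ext v; rfl
  rw [← h]
  exact ⟨ContinuousLinearEquiv.toUnit e', rfl⟩

theorem exists_isPosSqrt {A : X →L[ℝ] X} (hA : A.IsPositive) : ∃ S, IsPosSqrt A S := by
  have hs : (A : X →ₗ[ℝ] X).IsSymmetric := hA.isSymmetric
  let b := hs.eigenvectorBasis rfl
  let l := hs.eigenvalues rfl
  have hAb : ∀ i, A (b i) = l i • b i := fun i =>
    hs.apply_eigenvectorBasis rfl i
  have hl : ∀ i, 0 ≤ l i := fun i => by
    have h := hA.inner_nonneg_right (b i)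
    rw [hAb, inner_smul_right, real_inner_self_eq_norm_sq, b.norm_eq_one] at h
    simpa using h
  let S : X →L[ℝ] X := ∑ i, Real.sqrt (l i) • InnerProductSpace.rankOne ℝ (b i) (b i)
  have hSb : ∀ j, S (b j) = Real.sqrt (l j) • b j := fun j => by
    simp only [S, sum_apply, smul_apply,
      InnerProductSpace.rankOne_apply]
    rw [Finset.sum_eq_single j]
    · simp
    · intro i _ hij
      simp [b.inner_eq_zero hij]
    · simp
  refine ⟨S, ?_, ?_⟩
  · refine ContinuousLinearMap.isPositive_sum _ fun i _ => ?_
    exact (InnerProductSpace.isPositive_rankOne_self (b i)).smul_of_nonneg (Real.sqrt_nonneg _)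
  · apply ContinuousLinearMap.coe_injective
    refine b.toBasis.ext fun j => ?_
    simp [hSb, hAb, smul_smul, Real.mul_self_sqrt (hl j)]

theorem IsPosSqrt.unique {A S T : X →L[ℝ] X} (hS : IsPosSqrt A S) (hT : IsPosSqrt A T) :
    S = T := by
  have hs : ((S - T : X →L[ℝ] X) : X →ₗ[ℝ] X).IsSymmetric := by
    have := hS.1.isSymmetric.sub hT.1.isSymmetric
    simpa using this
  let b := hs.eigenvectorBasis rfl
  let l := hs.eigenvalues rfl
  have hb : ∀ i, S (b i) - T (b i) = l i • b i := fun i => by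
    simpa using hs.apply_eigenvectorBasis rfl i
  have h0 : ∀ i, l i = 0 := fun i => by
    by_contra hne
    have hs0 := hS.1.inner_nonneg_right (b i)
    have ht0 := hT.1.inner_nonneg_right (b i)
    have e1 : S (S (b i)) = T (T (b i)) := by
      have h1 := congrArg (fun B : X →L[ℝ] X => B (b i)) (hS.2.trans hT.2.symm)
      simpa using h1
    have e2 : S (S (b i) - T (b i)) + (S (T (b i)) - T (T (b i))) = 0 := by
      rw [map_sub, e1]; abel
    have e3 : ⟪b i, S (T (b i)) - T (T (b i))⟫_ℝ = l i * ⟪b i, T (b i)⟫_ℝ := by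
      have h1 := hs (b i) (T (b i))
      simp only [ContinuousLinearMap.coe_coe, sub_apply] at h1
      rw [← h1, hb, inner_smul_left]
      simp
    have e4 : l i * ⟪b i, S (b i)⟫_ℝ + l i * ⟪b i, T (b i)⟫_ℝ = 0 := by
      have h1 := congrArg (fun v => ⟪b i, v⟫_ℝ) e2
      simp only [inner_add_right, inner_zero_right] at h1
      rw [e3, hb, map_smul, inner_smul_right] at h1
      exact h1
    have e5 : ⟪b i, S (b i)⟫_ℝ + ⟪b i, T (b i)⟫_ℝ = 0 := by
      rw [← mul_add] at e4
      exact (mul_eq_zero.1 e4).resolve_left hne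
    have e6 : ⟪b i, S (b i) - T (b i)⟫_ℝ = l i := by
      rw [hb, inner_smul_right, real_inner_self_eq_norm_sq, b.norm_eq_one]; simp
    rw [inner_sub_right] at e6
    exact hne (by linarith)
  apply ContinuousLinearMap.coe_injective
  refine b.toBasis.ext fun j => ?_
  have h1 := hb j
  rw [h0, zero_smul, sub_eq_zero] at h1
  simpa using h1

theorem frob_add_right (A B C : X →L[ℝ] X) : frob A (B + C) = frob A B + frob A C := by
  simp [frob, opTrace, mul_add]

theorem frob_smul_right (c : ℝ) (A B : X →L[ℝ] X) : frob A (c • B) = c * frob A B := by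
  simp [frob, opTrace]

theorem frob_add_left (A B C : X →L[ℝ] X) : frob (A + B) C = frob A C + frob B C := by
  simp [frob, opTrace, add_mul]

theorem frob_smul_left (c : ℝ) (A B : X →L[ℝ] X) : frob (c • A) B = c * frob A B := by
  simp [frob, opTrace]

theorem frob_self_eq_zero {A : X →L[ℝ] X} (h : frob A A = 0) : A = 0 := by
  let b := stdOrthonormalBasis ℝ X
  have h1 : frob A A = ∑ i, ‖A (b i)‖ ^ 2 := by
    rw [frob, opTrace, LinearMap.trace_eq_sum_inner _ b]
    refine Finset.sum_congr rfl fun i _ => ?_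
    simp [ContinuousLinearMap.star_eq_adjoint, ContinuousLinearMap.adjoint_inner_right]
  rw [h1, Finset.sum_eq_zero_iff_of_nonneg (fun i _ => by positivity)] at h
  apply ContinuousLinearMap.coe_injective
  refine b.toBasis.ext fun j => ?_
  have := h j (Finset.mem_univ _)
  simpa using this

theorem exists_isFrobProj (H : Submodule ℝ (X →L[ℝ] X)) (A : X →L[ℝ] X) :
    ∃ P, IsFrobProj H A P := by
  let Φ : H →ₗ[ℝ] Module.Dual ℝ H := LinearMap.mk₂ ℝ (fun P F => frob (F : X →L[ℝ] X) P)
    (fun a b c => by simp [frob_add_right]) (fun a b c => by simp [frob_smul_right])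
    (fun a b c => by simp [frob_add_left]) (fun a b c => by simp [frob_smul_left])
  have hinj : Function.Injective Φ := by
    rw [← LinearMap.ker_eq_bot, LinearMap.ker_eq_bot']
    intro P hP
    have h1 : frob (P : X →L[ℝ] X) P = 0 := by
      have := congrArg (fun φ => φ P) hP
      simpa [Φ] using this
    exact Subtype.ext (frob_self_eq_zero h1)
  have hsurj : Function.Surjective Φ :=
    (LinearMap.injective_iff_surjective_of_finrank_eq_finrank
      (Subspace.dual_finrank_eq (K := ℝ) (V := H)).symm).1 hinj
  let ψ : Module.Dual ℝ H :=
    { toFun := fun F => frob (F : X →L[ℝ] X) A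
      map_add' := fun a b => by simp [frob_add_left]
      map_smul' := fun c a => by simp [frob_smul_left] }
  obtain ⟨P, hP⟩ := hsurj ψ
  refine ⟨P, P.2, fun F hF => ?_⟩
  have h1 : frob F P = frob F A := congrArg (fun φ => φ ⟨F, hF⟩) hP
  have h2 : A - (P : X →L[ℝ] X) = A + (-1 : ℝ) • (P : X →L[ℝ] X) := by
    rw [neg_one_smul, sub_eq_add_neg]
  rw [h2, frob_add_right, frob_smul_right, h1]
  ring

theorem IsFrobProj.unique {H : Submodule ℝ (X →L[ℝ] X)} {A P P' : X →L[ℝ] X}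
    (hP : IsFrobProj H A P) (hP' : IsFrobProj H A P') : P = P' := by
  have h : frob (P - P') (P - P') = 0 := by
    have h1 := hP.2 (P - P') (H.sub_mem hP.1 hP'.1)
    have h2 := hP'.2 (P - P') (H.sub_mem hP.1 hP'.1)
    have h3 : A - P' = (A - P) + (P - P') := by abel
    rw [h3, frob_add_right, h1, zero_add] at h2
    exact h2
  exact sub_eq_zero.1 (frob_self_eq_zero h)

open Classical in
/-- The positive semidefinite square root of a positive semidefinite operator
(it exists and is unique, see `exists_isPosSqrt` and `IsPosSqrt.unique`). -/
def opSqrt (A : X →L[ℝ] X) : X →L[ℝ] X :=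
  if h : ∃ S, IsPosSqrt A S then h.choose else 0

theorem opSqrt_spec {A : X →L[ℝ] X} (hA : A.IsPositive) : IsPosSqrt A (opSqrt A) := by
  have h := exists_isPosSqrt hA
  rw [opSqrt, dif_pos h]
  exact h.choose_spec

/-- The orthogonal projection of an operator onto the subspace `H`, for the Frobenius inner
product (it exists and is unique, see `exists_isFrobProj` and `IsFrobProj.unique`). -/
def opProj (H : Submodule ℝ (X →L[ℝ] X)) (A : X →L[ℝ] X) : X →L[ℝ] X :=
  (exists_isFrobProj H A).choose

theorem opProj_spec (H : Submodule ℝ (X →L[ℝ] X)) (A : X →L[ℝ] X) :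
    IsFrobProj H A (opProj H A) :=
  (exists_isFrobProj H A).choose_spec

/-! ### The structural assumption and the norms it induces -/

/-- The structural assumption on the space `H` of operators. -/
structure IsStructured (H : Submodule ℝ (X →L[ℝ] X)) : Prop where
  selfAdjoint : ∀ A ∈ H, IsSelfAdjoint A
  one_mem : (1 : X →L[ℝ] X) ∈ H
  conj_mem : ∀ A ∈ H, ∀ B ∈ H, A * B * A ∈ H
  proj_posDef : ∀ A : X →L[ℝ] X, PosDef A → PosDef (opProj H A)

/-- The norm `R(x) = ‖√(proj_H (x⟨x,·⟩))‖_op`. -/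
def normR (H : Submodule ℝ (X →L[ℝ] X)) (x : X) : ℝ :=
  ‖opSqrt (opProj H (InnerProductSpace.rankOne ℝ x x))‖

/-- The dual norm `R_*(x) = ‖√(proj_H (x⟨x,·⟩))‖_tr`. -/
def normRdual (H : Submodule ℝ (X →L[ℝ] X)) (x : X) : ℝ :=
  opTrace (opSqrt (opProj H (InnerProductSpace.rankOne ℝ x x)))

/-- The ball `Q = {x : R(x) ≤ D}` of possibly infinite radius `D`. -/
def ballQ (H : Submodule ℝ (X →L[ℝ] X)) (D : ℝ≥0∞) : Set X :=
  {x | ENNReal.ofReal (normR H x) ≤ D}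

/-- The optimal value `f^* = inf_{x ∈ Q} f(x)`. -/
def optValue (H : Submodule ℝ (X →L[ℝ] X)) (D : ℝ≥0∞) (f : X → ℝ) : ℝ :=
  sInf (f '' ballQ H D)

open Classical in
/-- The convergence criterion: the Frank-Wolfe gap over `Q`, scaled by `1 / D`, if `D < ∞`,
and the dual norm of the gradient if `D = ∞`. -/
def gap (H : Submodule ℝ (X →L[ℝ] X)) (D : ℝ≥0∞) (f : X → ℝ) (x : X) : ℝ :=
  if D = ⊤ then normRdual H (∇ f x)
  else (1 / D.toReal) * sSup ((fun y => ⟪∇ f x, x - y⟫_ℝ) '' ballQ H D)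

/-! ### Assumptions on the objective function and on the gradient oracle -/

/-- `f` is continuously differentiable and `1`-smooth with respect to `‖·‖_L`: its Bregman
divergence satisfies `|f(x) - f(x') - ⟨∇f(x'), x - x'⟩| ≤ ‖x - x'‖²_L / 2`. -/
structure IsWeightedSmooth (f : X → ℝ) (L : X →L[ℝ] X) : Prop where
  contDiff : ContDiff ℝ 1 f
  bregman : ∀ x x' : X,
    |f x - f x' - ⟪∇ f x', x - x'⟫_ℝ| ≤ (1 / 2) * wnormSq L (x - x')

/-- `g(x; ξ)`, `ξ ∼ μ`, is an unbiased estimator of `∇f(x)`, and its noise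
`n(x; ξ) = g(x; ξ) - ∇f(x)` satisfies `E ‖n(x; ξ)‖²_{Σ⁻¹} ≤ tr Σ`. -/
structure IsGradientOracle [MeasurableSpace X] {Ξ : Type*} [MeasurableSpace Ξ] (f : X → ℝ)
    (g : X → Ξ → X) (μ : Measure Ξ) (S : X →L[ℝ] X) : Prop where
  measurable : Measurable (Function.uncurry g)
  integrable : ∀ x, Integrable (g x) μ
  unbiased : ∀ x, ∫ z, g x z ∂μ = ∇ f x
  integrable_noise : ∀ x, Integrable (fun z => wnormSq (Ring.inverse S) (g x z - ∇ f x)) μ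
  variance_le : ∀ x, ∫ z, wnormSq (Ring.inverse S) (g x z - ∇ f x) ∂μ ≤ opTrace S

/-! ### The algorithm -/

/-- `x`, `m`, `ξ` are the iterates, momenta and samples of `K` iterations of non-Euclidean SGD
with weight decay `β`, stepsize `η`, and ordinary momentum with parameter `α`.
The filtration `ℱ` records the information available when iteration `k` starts: the samples are
drawn from `μ`, each new one independently of the past, and the minimizer `x (k + 1)` is selected
(measurably, by an arbitrary and possibly randomized rule) before `ξ (k + 1)` is drawn. -/
structure IsRun [MeasurableSpace X] {Ξ Ω : Type*} [MeasurableSpace Ξ] [mΩ : MeasurableSpace Ω]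
    (H : Submodule ℝ (X →L[ℝ] X)) (g : X → Ξ → X) (μ : Measure Ξ) (x₀ : X) (α β η : ℝ) (K : ℕ)
    (P : Measure Ω) (ℱ : Filtration ℕ mΩ) (ξ : ℕ → Ω → Ξ) (x m : ℕ → Ω → X) : Prop where
  sample_measurable : ∀ k ≤ K, Measurable[ℱ k] (ξ k)
  sample_law : ∀ k ≤ K, P.map (ξ k) = μ
  sample_indep : ∀ k < K, Indep (MeasurableSpace.comap (ξ (k + 1)) inferInstance) (ℱ k) P
  x_zero : ∀ ω, x 0 ω = x₀
  m_zero : ∀ ω, m 0 ω = g x₀ (ξ 0 ω)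
  x_measurable : ∀ k < K, Measurable[ℱ k] (x (k + 1))
  x_feasible : ∀ k < K, ∀ ω, normR H (x (k + 1) ω - (1 - β) • x k ω) ≤ η
  x_minimal : ∀ k < K, ∀ ω, ∀ y : X, normR H (y - (1 - β) • x k ω) ≤ η →
    ⟪m k ω, x (k + 1) ω - x k ω⟫_ℝ ≤ ⟪m k ω, y - x k ω⟫_ℝ
  m_step : ∀ k < K, ∀ ω,
    m (k + 1) ω = (1 - α) • m k ω + α • g (x (k + 1) ω) (ξ (k + 1) ω)

end NonEuclideanSGD

end

/-! Write `M_x` for the projection of `x⟨x,·⟩` onto `H`. Elements `F ∈ H` do not distinguish an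
operator from its projection, so `⟨x, F x⟩ = tr(F M_x)`. Moreover `H` contains `I` and is closed
under `A B A`, hence contains every function of its elements. Testing the identity on functions of
`M_x` shows that `R` and `R_*` are dual norms (`inner_le`, `exists_inner_eq`, `normR_add_le`).
Testing it on weights gives `‖x‖²_F ≤ tr(F) R(x)²` for positive `F ∈ H` (`wnormSq_le`) and, after
optimizing over `s` in `two_mul_normRdual_le`, `R_*(x)² ≤ tr(S) ‖x‖²_{S⁻¹}`. So `f` is smooth for
`R` with a constant of order `tr L`, and the mean noise in `R_*` is at most `tr S`.

The rest is the analysis of a conditional-gradient method with inexact gradients. A step lowers `f`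
by `η · gap`, up to `2 η R_*(m - ∇f) + 2 tr(L) η²` (`descent`). The momentum error splits into a
deterministic drift of order `tr(L) η / α` and an averaged noise. The latter is estimated in the
Euclidean norm `‖·‖_{S⁻¹}`, where independent contributions are orthogonal, and has mean dual norm
at most `tr(S) ((1 - α)^k + √α)`.

Without convexity, the descent inequality is summed and telescoped. With convexity, `D · gap ≥ f -
f*` and `η = β D` turn it into a contraction. The parameters make every error term a fixed fraction
of `ε`. -/

noncomputable section

namespace NonEuclideanSGD

variable {X : Type*} [NormedAddCommGroup X] [InnerProductSpace ℝ X] [FiniteDimensional ℝ X]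
  [CompleteSpace X]

/-! ### Operators that are diagonal in an orthonormal basis -/

section Diagonal

variable {ι : Type*} [Fintype ι] {b : OrthonormalBasis ι ℝ X} {c : ι → ℝ} {T : X →L[ℝ] X}

theorem apply_of_diagonal (hT : ∀ i, T (b i) = c i • b i) (x : X) :
    T x = ∑ i, (c i * ⟪b i, x⟫_ℝ) • b i := by
  conv_lhs => rw [← b.sum_repr' x]
  simp [map_sum, hT, smul_smul, mul_comm]

theorem inner_apply_of_diagonal (hT : ∀ i, T (b i) = c i • b i) (x : X) :
    ⟪x, T x⟫_ℝ = ∑ i, c i * ⟪b i, x⟫_ℝ ^ 2 := by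
  rw [apply_of_diagonal hT, inner_sum]
  refine Finset.sum_congr rfl fun i _ => ?_
  rw [inner_smul_right, real_inner_comm]
  ring

theorem inner_basis_apply_of_diagonal (hT : ∀ i, T (b i) = c i • b i) (x : X) (i : ι) :
    ⟪b i, T x⟫_ℝ = c i * ⟪b i, x⟫_ℝ := by
  classical
  rw [apply_of_diagonal hT, inner_sum, Finset.sum_eq_single i]
  · rw [inner_smul_right, real_inner_self_eq_norm_sq, b.norm_eq_one]; ring
  · intro j _ hj
    rw [inner_smul_right, b.inner_eq_zero hj.symm, mul_zero]
  · simp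

theorem norm_sq_eq_sum (b : OrthonormalBasis ι ℝ X) (x : X) :
    ‖x‖ ^ 2 = ∑ i, ⟪b i, x⟫_ℝ ^ 2 := by
  rw [← b.sum_sq_norm_inner_right x]
  simp

theorem norm_apply_sq_of_diagonal (hT : ∀ i, T (b i) = c i • b i) (x : X) :
    ‖T x‖ ^ 2 = ∑ i, c i ^ 2 * ⟪b i, x⟫_ℝ ^ 2 := by
  rw [norm_sq_eq_sum b]
  refine Finset.sum_congr rfl fun i _ => ?_
  rw [inner_basis_apply_of_diagonal hT, mul_pow]

theorem opTrace_eq_sum (b : OrthonormalBasis ι ℝ X) (A : X →L[ℝ] X) :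
    opTrace A = ∑ i, ⟪b i, A (b i)⟫_ℝ := by
  rw [opTrace, LinearMap.trace_eq_sum_inner _ b]; rfl

theorem opTrace_of_diagonal (hT : ∀ i, T (b i) = c i • b i) : opTrace T = ∑ i, c i := by
  rw [opTrace_eq_sum b]
  refine Finset.sum_congr rfl fun i _ => ?_
  rw [hT, inner_smul_right, real_inner_self_eq_norm_sq, b.norm_eq_one]; simp

theorem isPositive_of_diagonal (hs : IsSelfAdjoint T) (hT : ∀ i, T (b i) = c i • b i)
    (hc : ∀ i, 0 ≤ c i) : T.IsPositive := by
  rw [ContinuousLinearMap.isPositive_iff']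
  refine ⟨hs, fun x => ?_⟩
  rw [real_inner_comm, inner_apply_of_diagonal hT]
  exact Finset.sum_nonneg fun i _ => mul_nonneg (hc i) (sq_nonneg _)

theorem norm_le_of_diagonal (hT : ∀ i, T (b i) = c i • b i) {C : ℝ} (hC : 0 ≤ C)
    (hc : ∀ i, |c i| ≤ C) : ‖T‖ ≤ C := by
  refine T.opNorm_le_bound hC fun x => ?_
  refine abs_le_of_sq_le_sq' ?_ (by positivity) |>.2
  rw [norm_apply_sq_of_diagonal hT, mul_pow, norm_sq_eq_sum b, Finset.mul_sum]
  refine Finset.sum_le_sum fun i _ => mul_le_mul_of_nonneg_right ?_ (sq_nonneg _)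
  exact sq_le_sq.2 ((hc i).trans (le_abs_self C))

theorem ext_of_diagonal {T' : X →L[ℝ] X} (hT : ∀ i, T (b i) = c i • b i)
    (hT' : ∀ i, T' (b i) = c i • b i) : T = T' := by
  ext x
  rw [apply_of_diagonal hT, apply_of_diagonal hT']

end Diagonal

theorem exists_eigenbasis {A : X →L[ℝ] X} (hA : IsSelfAdjoint A) :
    ∃ (b : OrthonormalBasis (Fin (Module.finrank ℝ X)) ℝ X) (l : Fin (Module.finrank ℝ X) → ℝ),
      ∀ i, A (b i) = l i • b i :=
  have hs : (A : X →ₗ[ℝ] X).IsSymmetric := hA.isSymmetric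
  ⟨hs.eigenvectorBasis rfl, hs.eigenvalues rfl, fun i => hs.apply_eigenvectorBasis rfl i⟩

theorem inner_apply_nonneg {A : X →L[ℝ] X} (hA : A.IsPositive) (v : X) : 0 ≤ ⟪v, A v⟫_ℝ :=
  hA.inner_nonneg_right v

/-! ### The functional calculus and the projection on a structured space of operators -/

namespace IsStructured

variable {H : Submodule ℝ (X →L[ℝ] X)} (hH : IsStructured H)
include hH

/-- Since `A^(n+2) = A · A^n · A`, closure under conjugation suffices, although `H` need not be
closed under products. -/
theorem pow_mem {A : X →L[ℝ] X} (hA : A ∈ H) : ∀ n : ℕ, A ^ n ∈ H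
  | 0 => by simpa using hH.one_mem
  | 1 => by simpa using hA
  | n + 2 => by
    have h := hH.conj_mem A hA _ (pow_mem hA n)
    rwa [← pow_succ', ← pow_succ] at h

theorem aeval_mem {A : X →L[ℝ] X} (hA : A ∈ H) (p : Polynomial ℝ) :
    Polynomial.aeval A p ∈ H := by
  rw [Polynomial.aeval_eq_sum_range]
  exact H.sum_mem fun i _ => H.smul_mem _ (hH.pow_mem hA i)

/-- Functional calculus inside `H`: only the values of `φ` at the finitely many eigenvalues matter,
so `φ` is replaced by its Lagrange interpolant and no regularity is needed. -/
theorem exists_mem_diagonal {ι : Type*} [Fintype ι] {b : OrthonormalBasis ι ℝ X} {l : ι → ℝ}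
    {A : X →L[ℝ] X} (hA : A ∈ H) (hb : ∀ i, A (b i) = l i • b i) (φ : ℝ → ℝ) :
    ∃ T ∈ H, ∀ i, T (b i) = φ (l i) • b i := by
  classical
  let p := Lagrange.interpolate (Finset.univ.image l) id φ
  refine ⟨Polynomial.aeval A p, hH.aeval_mem hA p, fun i => ?_⟩
  have hp : p.eval (l i) = φ (l i) :=
    Lagrange.eval_interpolate_at_node φ Function.injective_id.injOn
      (Finset.mem_image_of_mem l (Finset.mem_univ i))
  have hpow : ∀ n : ℕ, (A ^ n) (b i) = l i ^ n • b i := fun n => by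
    induction n with
    | zero => simp
    | succ n ih => rw [pow_succ, mul_apply_eq_comp, hb, map_smul, ih, smul_smul,
        pow_succ, mul_comm]
  rw [← hp, Polynomial.aeval_eq_sum_range, Polynomial.eval_eq_sum_range, Finset.sum_smul]
  simp [hpow, smul_smul]

omit hH in
theorem frob_rankOne (F : X →L[ℝ] X) (x : X) :
    frob F (InnerProductSpace.rankOne ℝ x x) = ⟪F x, x⟫_ℝ := by
  have h : star F * InnerProductSpace.rankOne ℝ x x =
      InnerProductSpace.rankOne ℝ (star F x) x := by
    ext v; simp
  rw [frob, h, opTrace, InnerProductSpace.trace_rankOne, ContinuousLinearMap.star_eq_adjoint,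
    ContinuousLinearMap.adjoint_inner_right, real_inner_comm]

omit hH in
theorem frob_sub_right (A B C : X →L[ℝ] X) : frob A (B - C) = frob A B - frob A C := by
  rw [sub_eq_add_neg, ← neg_one_smul ℝ C, frob_add_right, frob_smul_right]; ring

omit hH in
theorem frob_opProj {F : X →L[ℝ] X} (hF : F ∈ H) (A : X →L[ℝ] X) :
    frob F (opProj H A) = frob F A := by
  have h := (opProj_spec H A).2 F hF
  rw [frob_sub_right] at h
  linarith

theorem frob_eq_trace {F A : X →L[ℝ] X} (hF : F ∈ H) : frob F A = opTrace (F * A) := by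
  rw [frob, (hH.selfAdjoint F hF).star_eq]

theorem trace_mul_opProj {F : X →L[ℝ] X} (hF : F ∈ H) (x : X) :
    opTrace (F * opProj H (InnerProductSpace.rankOne ℝ x x)) = ⟪x, F x⟫_ℝ := by
  rw [← hH.frob_eq_trace hF, frob_opProj hF, frob_rankOne, real_inner_comm]

omit hH in
theorem opProj_mem (A : X →L[ℝ] X) : opProj H A ∈ H := (opProj_spec H A).1

omit hH in
theorem opProj_eq {A P : X →L[ℝ] X} (hP : P ∈ H) (h : ∀ F ∈ H, frob F A = frob F P) :
    opProj H A = P :=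
  (opProj_spec H A).unique ⟨hP, fun F hF => by rw [frob_sub_right, h F hF, sub_self]⟩

/-- The structural assumption speaks only of positive definite operators. Adding `δ I`, which the
projection fixes because `I ∈ H`, makes it applicable; then `δ → 0`. -/
theorem isPositive_opProj (x : X) :
    (opProj H (InnerProductSpace.rankOne ℝ x x)).IsPositive := by
  set M := opProj H (InnerProductSpace.rankOne ℝ x x) with hM
  have key : ∀ δ : ℝ, 0 < δ → ∀ v : X, 0 ≤ ⟪v, M v⟫_ℝ + δ * ‖v‖ ^ 2 := by
    intro δ hδ v
    have hpos : PosDef (InnerProductSpace.rankOne ℝ x x + δ • (1 : X →L[ℝ] X)) := by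
      refine ⟨?_, fun w hw => ?_⟩
      · have h1 : (δ • (1 : X →L[ℝ] X)).IsPositive :=
          ContinuousLinearMap.isPositive_one.smul_of_nonneg hδ.le
        exact ((InnerProductSpace.isPositive_rankOne_self x).add h1).isSelfAdjoint
      · have h0 := inner_apply_nonneg (InnerProductSpace.isPositive_rankOne_self (𝕜 := ℝ) x) w
        have : 0 < δ * ‖w‖ ^ 2 := by have := norm_pos_iff.2 hw; positivity
        simp only [add_apply, smul_apply, one_apply_eq_self, inner_add_right,
          inner_smul_right, real_inner_self_eq_norm_sq] at h0 ⊢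
        linarith
    have heq : opProj H (InnerProductSpace.rankOne ℝ x x + δ • (1 : X →L[ℝ] X)) = M + δ • 1 := by
      refine opProj_eq (H.add_mem (opProj_mem _) (H.smul_mem _ hH.one_mem)) fun F hF => ?_
      rw [frob_add_right, frob_add_right, hM, frob_opProj hF]
    have h1 := (hH.proj_posDef _ hpos).2
    rw [heq] at h1
    by_cases hv : v = 0
    · simp [hv]
    · have := (h1 v hv).le
      simpa [inner_add_right, inner_smul_right, real_inner_self_eq_norm_sq] using this
  rw [ContinuousLinearMap.isPositive_iff']
  refine ⟨hH.selfAdjoint M (opProj_mem _), fun v => ?_⟩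
  rw [real_inner_comm]
  by_contra hneg
  push Not at hneg
  have hd : 0 < -⟪v, M v⟫_ℝ / (2 * (‖v‖ ^ 2 + 1)) := by
    have : 0 < -⟪v, M v⟫_ℝ := by linarith
    positivity
  have h := key _ hd v
  have h2 : -⟪v, M v⟫_ℝ / (2 * (‖v‖ ^ 2 + 1)) * ‖v‖ ^ 2 ≤ -⟪v, M v⟫_ℝ / 2 := by
    rw [div_mul_eq_mul_div, div_le_div_iff₀ (by positivity) (by norm_num)]
    nlinarith [sq_nonneg ‖v‖]
  linarith

/-- The spectral identity behind all properties of `normR` and `normRdual`. -/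
theorem exists_spectral (x : X) :
    ∃ (b : OrthonormalBasis (Fin (Module.finrank ℝ X)) ℝ X) (l : Fin (Module.finrank ℝ X) → ℝ),
      (∀ i, opProj H (InnerProductSpace.rankOne ℝ x x) (b i) = l i • b i) ∧ (∀ i, 0 ≤ l i) ∧
      (∀ φ : ℝ → ℝ, ∑ i, φ (l i) * ⟪b i, x⟫_ℝ ^ 2 = ∑ i, φ (l i) * l i) ∧
      (∀ i, opSqrt (opProj H (InnerProductSpace.rankOne ℝ x x)) (b i) = √(l i) • b i) := by
  set M := opProj H (InnerProductSpace.rankOne ℝ x x) with hM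
  have hMH : M ∈ H := opProj_mem _
  obtain ⟨b, l, hb⟩ := exists_eigenbasis (hH.selfAdjoint M hMH)
  have hl : ∀ i, 0 ≤ l i := fun i => by
    have h := inner_apply_nonneg (hH.isPositive_opProj x) (b i)
    rw [← hM, hb, inner_smul_right, real_inner_self_eq_norm_sq, b.norm_eq_one] at h
    simpa using h
  refine ⟨b, l, hb, hl, fun φ => ?_, fun i => ?_⟩
  -- With `T = φ(M) ∈ H`, both sides are `⟨x, T x⟩ = tr(T M)`, written in the eigenbasis of `M`.
  · obtain ⟨T, hT, hTb⟩ := hH.exists_mem_diagonal hMH hb φ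
    rw [← inner_apply_of_diagonal hTb, ← hH.trace_mul_opProj hT]
    refine opTrace_of_diagonal (b := b) fun i => ?_
    rw [mul_apply_eq_comp, ← hM, hb, map_smul, hTb, smul_smul, mul_comm]
  · obtain ⟨T, hT, hTb⟩ := hH.exists_mem_diagonal hMH hb Real.sqrt
    have hTM : IsPosSqrt M T := by
      refine ⟨isPositive_of_diagonal (hH.selfAdjoint T hT) hTb fun i => Real.sqrt_nonneg _, ?_⟩
      refine ext_of_diagonal (b := b) (c := l) (fun i => ?_) hb
      rw [mul_apply_eq_comp, hTb, map_smul, hTb, smul_smul, Real.mul_self_sqrt (hl i)]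
    rw [(opSqrt_spec (hH.isPositive_opProj x)).unique hTM, hTb]

/-! ### The norms `R` and `R_*`: domination, duality, norm axioms. -/

theorem normR_sq (x : X) :
    normR H x ^ 2 = ‖opProj H (InnerProductSpace.rankOne ℝ x x)‖ := by
  obtain ⟨hp, hs⟩ := opSqrt_spec (hH.isPositive_opProj x)
  conv_rhs => rw [← hs]
  conv_rhs => rw [← hp.isSelfAdjoint.star_eq]
  rw [normR, sq]
  have := CStarRing.norm_star_mul_self (x := opSqrt (opProj H (InnerProductSpace.rankOne ℝ x x)))
  rw [← this, hp.isSelfAdjoint.star_eq]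

omit hH in
theorem normR_nonneg (x : X) : 0 ≤ normR H x := norm_nonneg _

theorem opTrace_nonneg_of_isPositive {A : X →L[ℝ] X} (hA : A.IsPositive) : 0 ≤ opTrace A := by
  rw [opTrace_eq_sum (stdOrthonormalBasis ℝ X)]
  exact Finset.sum_nonneg fun i _ => inner_apply_nonneg hA _

theorem normRdual_nonneg (x : X) : 0 ≤ normRdual H x :=
  hH.opTrace_nonneg_of_isPositive (opSqrt_spec (hH.isPositive_opProj x)).1

/-- The weighted norms are dominated by `normR`. -/
theorem wnormSq_le {F : X →L[ℝ] X} (hF : F ∈ H) (hpos : F.IsPositive) (x : X) :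
    wnormSq F x ≤ opTrace F * normR H x ^ 2 := by
  obtain ⟨N, hN, hNF⟩ := exists_isPosSqrt hpos
  let b := stdOrthonormalBasis ℝ X
  have hsym : ∀ u v, ⟪N u, v⟫_ℝ = ⟪u, N v⟫_ℝ := hN.inner_left_eq_inner_right
  rw [wnormSq, ← hH.trace_mul_opProj hF, hH.normR_sq]
  set M := opProj H (InnerProductSpace.rankOne ℝ x x) with hM
  -- Splitting `F = N²` symmetrically makes each diagonal entry of `N M N` at most `‖M‖` times that
  -- of `F`.
  have h1 : opTrace (F * M) = opTrace (N * M * N) := by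
    have := LinearMap.trace_mul_comm ℝ (N : X →ₗ[ℝ] X) ((N * M : X →L[ℝ] X) : X →ₗ[ℝ] X)
    rw [← hNF, mul_assoc]
    exact this
  rw [h1, opTrace_eq_sum b, opTrace_eq_sum b, Finset.sum_mul]
  refine Finset.sum_le_sum fun i _ => ?_
  have e1 : ⟪b i, (N * M * N) (b i)⟫_ℝ = ⟪N (b i), M (N (b i))⟫_ℝ := by
    rw [hsym]; rfl
  have e2 : ⟪b i, F (b i)⟫_ℝ = ‖N (b i)‖ * ‖N (b i)‖ := by
    rw [← hNF, mul_apply_eq_comp, ← hsym, real_inner_self_eq_norm_mul_norm]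
  rw [e1, e2]
  calc ⟪N (b i), M (N (b i))⟫_ℝ ≤ ‖N (b i)‖ * ‖M (N (b i))‖ := real_inner_le_norm _ _
    _ ≤ ‖N (b i)‖ * (‖M‖ * ‖N (b i)‖) := by gcongr; exact M.le_opNorm _
    _ = _ := by ring

/-- Cauchy–Schwarz with weight `√M_y ∈ H`, whose trace is `R_*(y)`: `wnormSq_le` gives `⟨x, √M_y x⟩
≤ R_*(y) R(x)²`, while the spectral identity gives `⟨y, M_y^{-1/2} y⟩ = R_*(y)`. -/
theorem inner_le (x y : X) : ⟪x, y⟫_ℝ ≤ normR H x * normRdual H y := by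
  obtain ⟨b, l, hb, hl, hspec, hsqrt⟩ := hH.exists_spectral y
  have hdual : normRdual H y = ∑ i, √(l i) := opTrace_of_diagonal hsqrt
  -- Taking the indicator of `{0}` for `φ` shows that `y` has no component in the kernel of `M_y`,
  -- so the pseudo-inverse of `√M_y` loses nothing.
  have hzero : ∀ i, l i = 0 → ⟪b i, y⟫_ℝ = 0 := by
    have h := hspec fun t => if t = 0 then 1 else 0
    have h0 : ∑ i, (if l i = 0 then (1 : ℝ) else 0) * l i = 0 :=
      Finset.sum_eq_zero fun i _ => by split_ifs with hi <;> simp [hi]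
    rw [h0, Finset.sum_eq_zero_iff_of_nonneg] at h
    · intro i hi
      have := h i (Finset.mem_univ i)
      simpa [hi] using this
    · intro i _
      split_ifs <;> positivity
  have hx : ∑ i, √(l i) * ⟪b i, x⟫_ℝ ^ 2 ≤ normRdual H y * normR H x ^ 2 := by
    obtain ⟨T, hT, hTb⟩ := hH.exists_mem_diagonal (opProj_mem _) hb Real.sqrt
    rw [← inner_apply_of_diagonal hTb, hdual, ← opTrace_of_diagonal hTb]
    exact hH.wnormSq_le hT
      (isPositive_of_diagonal (hH.selfAdjoint T hT) hTb fun i => Real.sqrt_nonneg _) x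
  have hy : ∑ i, (√(l i))⁻¹ * ⟪b i, y⟫_ℝ ^ 2 = normRdual H y := by
    rw [hspec fun t => (√t)⁻¹, hdual]
    refine Finset.sum_congr rfl fun i _ => ?_
    rcases (hl i).eq_or_lt with h | h
    · simp [← h]
    · have := Real.sqrt_pos.2 h
      field_simp
      rw [Real.sq_sqrt h.le]
  -- The AM-GM weight `r` must be positive but `R(x)` may vanish, so all `r ≥ R(x)` are treated and
  -- `r` is then lowered to `R(x)`.
  have hmain : ∀ r : ℝ, 0 < r → normR H x ≤ r → ⟪x, y⟫_ℝ ≤ r * normRdual H y := by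
    intro r hr hxr
    have hsum : ⟪x, y⟫_ℝ ≤ ∑ i, (1 / 2) * (r⁻¹ * (√(l i) * ⟪b i, x⟫_ℝ ^ 2) +
        r * ((√(l i))⁻¹ * ⟪b i, y⟫_ℝ ^ 2)) := by
      rw [← b.sum_inner_mul_inner x y]
      refine Finset.sum_le_sum fun i _ => ?_
      rw [real_inner_comm]
      rcases (hl i).eq_or_lt with h | h
      · simp [← h, hzero i h.symm]
      · have hs := Real.sqrt_pos.2 h
        have h2 : (1 / 2) * (r⁻¹ * (√(l i) * ⟪b i, x⟫_ℝ ^ 2) + r * ((√(l i))⁻¹ * ⟪b i, y⟫_ℝ ^ 2))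
            - ⟪b i, x⟫_ℝ * ⟪b i, y⟫_ℝ =
            (√(l i) * ⟪b i, x⟫_ℝ - r * ⟪b i, y⟫_ℝ) ^ 2 / (2 * r * √(l i)) := by
          field_simp
          ring
        have : 0 ≤ (√(l i) * ⟪b i, x⟫_ℝ - r * ⟪b i, y⟫_ℝ) ^ 2 / (2 * r * √(l i)) := by positivity
        linarith
    rw [← Finset.mul_sum, Finset.sum_add_distrib, ← Finset.mul_sum, ← Finset.mul_sum, hy] at hsum
    have h3 : r⁻¹ * ∑ i, √(l i) * ⟪b i, x⟫_ℝ ^ 2 ≤ r * normRdual H y := by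
      rw [inv_mul_le_iff₀ hr]
      refine hx.trans ?_
      have := hH.normRdual_nonneg y
      have h4 : normR H x ^ 2 ≤ r ^ 2 := pow_le_pow_left₀ (normR_nonneg x) hxr 2
      nlinarith
    linarith
  refine le_of_forall_pos_le_add fun δ hδ => ?_
  have hR := hH.normRdual_nonneg y
  have hx0 : 0 ≤ normR H x := normR_nonneg x
  have h := hmain (normR H x + δ / (normRdual H y + 1)) (by positivity)
    (by have : 0 < δ / (normRdual H y + 1) := by positivity
        linarith)
  have h2 : δ / (normRdual H y + 1) * normRdual H y ≤ δ := by
    rw [div_mul_eq_mul_div, div_le_iff₀ (by positivity)]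
    nlinarith
  linarith

theorem normR_le_of_diagonal {ι : Type*} [Fintype ι] {b : OrthonormalBasis ι ℝ X} {c : ι → ℝ}
    {x : X} (hb : ∀ i, opProj H (InnerProductSpace.rankOne ℝ x x) (b i) = c i • b i) {C : ℝ}
    (hC : 0 ≤ C) (hc : ∀ i, |c i| ≤ C ^ 2) : normR H x ≤ C := by
  refine abs_le_of_sq_le_sq' ?_ hC |>.2
  rw [hH.normR_sq]
  exact norm_le_of_diagonal hb (by positivity) hc

/-- The duality between `normR` and `normRdual` is attained. -/
theorem exists_inner_eq (y : X) : ∃ u, normR H u ≤ 1 ∧ ⟪y, u⟫_ℝ = normRdual H y := by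
  obtain ⟨b, l, hb, hl, hspec, hsqrt⟩ := hH.exists_spectral y
  have hdual : normRdual H y = ∑ i, √(l i) := opTrace_of_diagonal hsqrt
  have hMH : opProj H (InnerProductSpace.rankOne ℝ y y) ∈ H := opProj_mem _
  -- The maximizer is `M^{-1/2} y`; the convention `0⁻¹ = 0` makes this the pseudo-inverse on the
  -- kernel of `M`.
  obtain ⟨T, hT, hTb⟩ := hH.exists_mem_diagonal hMH hb fun t => (√t)⁻¹
  have hTs := (hH.selfAdjoint T hT).star_eq
  refine ⟨T y, ?_, ?_⟩
  · set M := opProj H (InnerProductSpace.rankOne ℝ y y) with hM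
    -- The projection commutes with conjugation by `T ∈ H`, by cyclicity of the trace. Here `T M T`
    -- is the spectral projector onto the range of `M`, so its norm is at most one.
    have hproj : opProj H (InnerProductSpace.rankOne ℝ (T y) (T y)) = T * M * T := by
      refine opProj_eq (hH.conj_mem T hT M hMH) fun F hF => ?_
      have hTFT := hH.conj_mem T hT F hF
      have h1 : frob F (T * M * T) = frob (T * F * T) M := by
        rw [hH.frob_eq_trace hF, hH.frob_eq_trace hTFT]
        have := LinearMap.trace_mul_comm ℝ ((F * T * M : X →L[ℝ] X) : X →ₗ[ℝ] X)
          (T : X →ₗ[ℝ] X)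
        have h2 : F * (T * M * T) = F * T * M * T := by noncomm_ring
        have h3 : T * F * T * M = T * (F * T * M) := by noncomm_ring
        rw [h2, h3]
        exact this
      rw [h1, hM, frob_opProj hTFT, frob_rankOne, frob_rankOne]
      have hsym : ∀ u v, ⟪T u, v⟫_ℝ = ⟪u, T v⟫_ℝ := fun u v => by
        conv_lhs => rw [← hTs]
        rw [ContinuousLinearMap.star_eq_adjoint, ContinuousLinearMap.adjoint_inner_left]
      rw [mul_apply_eq_comp, mul_apply_eq_comp, hsym]
    refine hH.normR_le_of_diagonal (b := b) (c := fun i => (√(l i))⁻¹ * l i * (√(l i))⁻¹)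
      (fun i => ?_) zero_le_one fun i => ?_
    · rw [hproj, mul_apply_eq_comp, hTb, map_smul, mul_apply_eq_comp, hb,
        map_smul, hTb, smul_smul, smul_smul]
    · rcases (hl i).eq_or_lt with h | h
      · simp [← h]
      · have h2 : (√(l i))⁻¹ * l i * (√(l i))⁻¹ = 1 := by
          have := Real.sqrt_pos.2 h
          field_simp
          rw [Real.sq_sqrt h.le]
        simp [h2]
  · rw [inner_apply_of_diagonal hTb, hspec fun t => (√t)⁻¹, hdual]
    refine Finset.sum_congr rfl fun i _ => ?_
    rcases (hl i).eq_or_lt with h | h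
    · simp [← h]
    · have := Real.sqrt_pos.2 h
      field_simp
      rw [Real.sq_sqrt h.le]

theorem normRdual_le {y : X} {C : ℝ} (h : ∀ u, normR H u ≤ 1 → ⟪y, u⟫_ℝ ≤ C) :
    normRdual H y ≤ C := by
  obtain ⟨u, hu, hy⟩ := hH.exists_inner_eq y
  exact hy ▸ h u hu

theorem inner_le_normRdual {u : X} (y : X) (hu : normR H u ≤ 1) : ⟪y, u⟫_ℝ ≤ normRdual H y := by
  rw [real_inner_comm]
  exact (hH.inner_le u y).trans
    (mul_le_of_le_one_left (hH.normRdual_nonneg y) hu)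

theorem normRdual_add_le (x y : X) : normRdual H (x + y) ≤ normRdual H x + normRdual H y :=
  hH.normRdual_le fun u hu => by
    rw [inner_add_left]
    exact add_le_add (hH.inner_le_normRdual x hu) (hH.inner_le_normRdual y hu)

/-- For an orthogonal projector `0 ≠ T ∈ H`, the seminorm `‖T v‖ / √(tr T)` is at most `R(v)`, by
`wnormSq_le`. For the top eigenspace of `M_{x+y}` it equals `R` at `x + y`, so the triangle
inequality is inherited from the Euclidean norm. -/
theorem normR_add_le (x y : X) : normR H (x + y) ≤ normR H x + normR H y := by
  obtain ⟨b, l, hb, hl, hspec, -⟩ := hH.exists_spectral (x + y)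
  have hxy : 0 ≤ normR H x + normR H y := add_nonneg (normR_nonneg x) (normR_nonneg y)
  rcases isEmpty_or_nonempty (Fin (Module.finrank ℝ X)) with hemp | hne
  · exact hH.normR_le_of_diagonal hb hxy fun i => hemp.elim i
  obtain ⟨i₀, hi₀⟩ := Finite.exists_max l
  obtain ⟨T, hT, hTb⟩ := hH.exists_mem_diagonal (opProj_mem _) hb fun t =>
    if t = l i₀ then 1 else 0
  have hpos : T.IsPositive := isPositive_of_diagonal (hH.selfAdjoint T hT) hTb fun i => by
    split_ifs <;> norm_num
  have htr : 0 < opTrace T := by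
    rw [opTrace_of_diagonal hTb]
    refine Finset.sum_pos' (fun i _ => by split_ifs <;> norm_num) ⟨i₀, Finset.mem_univ _, ?_⟩
    simp
  have hnorm : ∀ v, ‖T v‖ ^ 2 = wnormSq T v := fun v => by
    rw [norm_apply_sq_of_diagonal hTb, wnormSq, inner_apply_of_diagonal hTb]
    refine Finset.sum_congr rfl fun i _ => ?_
    split_ifs <;> simp
  have hle : ∀ v, ‖T v‖ ≤ √(opTrace T) * normR H v := fun v => by
    refine abs_le_of_sq_le_sq' ?_ (mul_nonneg (Real.sqrt_nonneg _) (normR_nonneg v)) |>.2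
    rw [hnorm, mul_pow, Real.sq_sqrt htr.le]
    exact hH.wnormSq_le hT hpos v
  have hmax : opTrace T * l i₀ = ‖T (x + y)‖ ^ 2 := by
    rw [hnorm, wnormSq, inner_apply_of_diagonal hTb, hspec fun t => if t = l i₀ then 1 else 0,
      opTrace_of_diagonal hTb, Finset.sum_mul]
    refine Finset.sum_congr rfl fun i _ => ?_
    split_ifs with h
    · rw [h]
    · simp
  have hbound : opTrace T * l i₀ ≤ opTrace T * (normR H x + normR H y) ^ 2 := by
    have h1 : ‖T (x + y)‖ ≤ √(opTrace T) * (normR H x + normR H y) := by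
      rw [map_add, mul_add]
      exact (norm_add_le _ _).trans (add_le_add (hle x) (hle y))
    have h2 := pow_le_pow_left₀ (norm_nonneg _) h1 2
    rwa [mul_pow, Real.sq_sqrt htr.le, ← hmax] at h2
  refine hH.normR_le_of_diagonal hb hxy fun i => ?_
  rw [abs_of_nonneg (hl i)]
  exact (hi₀ i).trans (le_of_mul_le_mul_left hbound htr)

theorem opSqrt_opProj_smul (c : ℝ) (x : X) :
    opSqrt (opProj H (InnerProductSpace.rankOne ℝ (c • x) (c • x))) =
      |c| • opSqrt (opProj H (InnerProductSpace.rankOne ℝ x x)) := by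
  have h1 : opProj H (InnerProductSpace.rankOne ℝ (c • x) (c • x)) =
      (|c| * |c|) • opProj H (InnerProductSpace.rankOne ℝ x x) := by
    refine opProj_eq (H.smul_mem _ (opProj_mem _)) fun F hF => ?_
    rw [frob_smul_right, frob_opProj hF, frob_rankOne, frob_rankOne, map_smul, inner_smul_left,
      inner_smul_right, abs_mul_abs_self]
    simp only [conj_trivial]
    ring
  refine (opSqrt_spec (hH.isPositive_opProj (c • x))).unique ?_
  obtain ⟨hp, hs⟩ := opSqrt_spec (hH.isPositive_opProj x)
  refine ⟨hp.smul_of_nonneg (abs_nonneg c), ?_⟩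
  rw [h1, smul_mul_smul_comm, hs]

theorem normR_smul (c : ℝ) (x : X) : normR H (c • x) = |c| * normR H x := by
  rw [normR, hH.opSqrt_opProj_smul, norm_smul, Real.norm_eq_abs, abs_abs]; rfl

theorem normRdual_smul (c : ℝ) (x : X) : normRdual H (c • x) = |c| * normRdual H x := by
  rw [normRdual, hH.opSqrt_opProj_smul, normRdual, opTrace, opTrace]
  simp

theorem normR_neg (x : X) : normR H (-x) = normR H x := by
  rw [← neg_one_smul ℝ x, hH.normR_smul]; simp

theorem normR_zero : normR H (0 : X) = 0 := by
  simpa using hH.normR_smul 0 (0 : X)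

theorem normRdual_zero : normRdual H (0 : X) = 0 := by
  simpa using hH.normRdual_smul 0 (0 : X)

theorem norm_sq_le (x : X) : ‖x‖ ^ 2 ≤ opTrace (1 : X →L[ℝ] X) * normR H x ^ 2 := by
  have h := hH.wnormSq_le hH.one_mem ContinuousLinearMap.isPositive_one x
  rwa [wnormSq, one_apply_eq_self, real_inner_self_eq_norm_sq] at h

theorem opTrace_one_nonneg : 0 ≤ opTrace (1 : X →L[ℝ] X) :=
  hH.opTrace_nonneg_of_isPositive ContinuousLinearMap.isPositive_one

theorem norm_le (x : X) : ‖x‖ ≤ √(opTrace (1 : X →L[ℝ] X)) * normR H x := by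
  refine abs_le_of_sq_le_sq' ?_ (mul_nonneg (Real.sqrt_nonneg _) (normR_nonneg x)) |>.2
  rw [mul_pow, Real.sq_sqrt hH.opTrace_one_nonneg]
  exact hH.norm_sq_le x

theorem normRdual_le_norm (x : X) : normRdual H x ≤ √(opTrace (1 : X →L[ℝ] X)) * ‖x‖ :=
  hH.normRdual_le fun u hu => by
    have h1 := hH.norm_le u
    have h2 : ‖u‖ ≤ √(opTrace (1 : X →L[ℝ] X)) :=
      h1.trans (mul_le_of_le_one_right (Real.sqrt_nonneg _) hu)
    calc ⟪x, u⟫_ℝ ≤ ‖x‖ * ‖u‖ := real_inner_le_norm _ _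
      _ ≤ ‖x‖ * √(opTrace (1 : X →L[ℝ] X)) := by gcongr
      _ = _ := mul_comm _ _

theorem continuous_normRdual : Continuous (normRdual H) := by
  have h : LipschitzWith (Real.toNNReal √(opTrace (1 : X →L[ℝ] X))) (normRdual H) := by
    refine LipschitzWith.of_le_add_mul' _ fun x y => ?_
    have h1 := hH.normRdual_add_le y (x - y)
    rw [add_sub_cancel] at h1
    rw [dist_eq_norm]
    exact h1.trans (by gcongr; exact hH.normRdual_le_norm _)
  exact h.continuous

end IsStructured

/-! ### Positive definite weights and their inverses. -/

omit [FiniteDimensional ℝ X] in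
theorem PosDef.isPositive {A : X →L[ℝ] X} (hA : PosDef A) : A.IsPositive := by
  rw [ContinuousLinearMap.isPositive_iff']
  refine ⟨hA.1, fun v => ?_⟩
  rw [real_inner_comm]
  by_cases hv : v = 0
  · simp [hv]
  · exact (hA.2 v hv).le

theorem PosDef.opTrace_pos [Nontrivial X] {A : X →L[ℝ] X} (hA : PosDef A) : 0 < opTrace A := by
  have hne : Nonempty (Fin (Module.finrank ℝ X)) := ⟨⟨0, Module.finrank_pos⟩⟩
  rw [opTrace_eq_sum (stdOrthonormalBasis ℝ X)]
  exact Finset.sum_pos (fun i _ => hA.2 _ ((stdOrthonormalBasis ℝ X).orthonormal.ne_zero i))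
    Finset.univ_nonempty

theorem inverse_apply_of_diagonal {ι : Type*} [Fintype ι] {b : OrthonormalBasis ι ℝ X}
    {σ : ι → ℝ} {S T : X →L[ℝ] X} (hσ : ∀ i, σ i ≠ 0) (hS : ∀ i, S (b i) = σ i • b i)
    (hT : ∀ i, T (b i) = (σ i)⁻¹ • b i) : Ring.inverse S = T := by
  have h1 : ∀ i, (1 : X →L[ℝ] X) (b i) = (1 : ℝ) • b i := fun i => by simp
  have hST : S * T = 1 := by
    refine ext_of_diagonal (b := b) (fun i => ?_) h1
    rw [mul_apply_eq_comp, hT, map_smul, hS, smul_smul, inv_mul_cancel₀ (hσ i)]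
  have hTS : T * S = 1 := by
    refine ext_of_diagonal (b := b) (fun i => ?_) h1
    rw [mul_apply_eq_comp, hS, map_smul, hT, smul_smul, mul_inv_cancel₀ (hσ i)]
  exact Ring.inverse_unit (⟨S, T, hST, hTS⟩ : (X →L[ℝ] X)ˣ)

theorem PosDef.exists_eigenbasis {S : X →L[ℝ] X} (hS : PosDef S) :
    ∃ (b : OrthonormalBasis (Fin (Module.finrank ℝ X)) ℝ X) (l : Fin (Module.finrank ℝ X) → ℝ),
      (∀ i, S (b i) = l i • b i) ∧ ∀ i, 0 < l i := by
  obtain ⟨b, l, hb⟩ := NonEuclideanSGD.exists_eigenbasis hS.1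
  refine ⟨b, l, hb, fun i => ?_⟩
  have h := hS.2 (b i) (b.orthonormal.ne_zero i)
  rw [hb, inner_smul_right, real_inner_self_eq_norm_sq, b.norm_eq_one] at h
  simpa using h

namespace IsStructured

variable {H : Submodule ℝ (X →L[ℝ] X)} (hH : IsStructured H)
include hH

theorem isPositive_inverse {S : X →L[ℝ] X} (hSH : S ∈ H) (hS : PosDef S) :
    (Ring.inverse S).IsPositive := by
  obtain ⟨b, l, hb, hl⟩ := hS.exists_eigenbasis
  obtain ⟨T, hT, hTb⟩ := hH.exists_mem_diagonal hSH hb fun t => t⁻¹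
  rw [inverse_apply_of_diagonal (fun i => (hl i).ne') hb hTb]
  exact isPositive_of_diagonal (hH.selfAdjoint T hT) hTb fun i => (inv_pos.2 (hl i)).le

/-- The dual norm is dominated by every weighted norm with weight in the inverse of `H`. -/
theorem two_mul_normRdual_le {S : X →L[ℝ] X} (hSH : S ∈ H) (hS : PosDef S) {s : ℝ} (hs : 0 < s)
    (x : X) : 2 * normRdual H x ≤ s * opTrace S + s⁻¹ * wnormSq (Ring.inverse S) x := by
  obtain ⟨b, l, hb, hl⟩ := hS.exists_eigenbasis
  obtain ⟨T, hT, hTb⟩ := hH.exists_mem_diagonal hSH hb fun t => t⁻¹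
  rw [inverse_apply_of_diagonal (fun i => (hl i).ne') hb hTb, wnormSq, ← hH.trace_mul_opProj hT,
    normRdual]
  obtain ⟨hp, hsq⟩ := opSqrt_spec (hH.isPositive_opProj x)
  set M := opProj H (InnerProductSpace.rankOne ℝ x x)
  set N := opSqrt M
  have hsymT : ∀ u v, ⟪T u, v⟫_ℝ = ⟪u, T v⟫_ℝ :=
    (isPositive_of_diagonal (hH.selfAdjoint T hT) hTb fun i =>
      (inv_pos.2 (hl i)).le).inner_left_eq_inner_right
  rw [opTrace_of_diagonal hb, opTrace_eq_sum b N, opTrace_eq_sum b (T * M), Finset.mul_sum,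
    Finset.mul_sum, Finset.mul_sum, ← Finset.sum_add_distrib]
  -- Everything is compared entrywise in the eigenbasis of `S`: `⟨b i, N b i⟩ ≤ ‖N b i‖`, then AM-GM
  -- with weight `s * l i`.
  refine Finset.sum_le_sum fun i _ => ?_
  have h1 : ⟪b i, (T * M) (b i)⟫_ℝ = (l i)⁻¹ * ‖N (b i)‖ ^ 2 := by
    rw [mul_apply_eq_comp, ← hsymT, hTb, inner_smul_left, ← hsq,
      mul_apply_eq_comp, ← hp.inner_left_eq_inner_right, real_inner_self_eq_norm_sq]
    simp
  have h2 : ⟪b i, N (b i)⟫_ℝ ≤ ‖N (b i)‖ := by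
    have := real_inner_le_norm (b i) (N (b i))
    rwa [b.norm_eq_one, one_mul] at this
  rw [h1]
  have hli := hl i
  have h3 : s * l i + s⁻¹ * ((l i)⁻¹ * ‖N (b i)‖ ^ 2) - 2 * ‖N (b i)‖ =
      (s * l i - ‖N (b i)‖) ^ 2 / (s * l i) := by
    field_simp
    ring
  have h4 : 0 ≤ (s * l i - ‖N (b i)‖) ^ 2 / (s * l i) := by positivity
  linarith

end IsStructured

/-! ### Smooth functions and the gap -/

namespace IsStructured

variable {H : Submodule ℝ (X →L[ℝ] X)} (hH : IsStructured H) {L : X →L[ℝ] X} {f : X → ℝ}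
  {D : ℝ≥0∞}
include hH

theorem abs_bregman_le (hL : L ∈ H) (hLp : PosDef L) (hf : IsWeightedSmooth f L) {x x' : X} {r : ℝ}
    (h : normR H (x - x') ≤ r) :
    |f x - f x' - ⟪∇ f x', x - x'⟫_ℝ| ≤ (1 / 2) * (opTrace L * r ^ 2) := by
  refine (hf.bregman x x').trans ?_
  have h1 := hH.wnormSq_le hL hLp.isPositive (x - x')
  have h2 : normR H (x - x') ^ 2 ≤ r ^ 2 := pow_le_pow_left₀ (normR_nonneg _) h 2
  have h3 := mul_le_mul_of_nonneg_left h2 (hH.opTrace_nonneg_of_isPositive hLp.isPositive)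
  linarith

/-- Compare `f` at `x`, `x'` and `x + r u`. The three Bregman errors, over distances at most `r`,
`2r` and `r`, add up to `(1 + 4 + 1)/2 · tr(L) r²`; dividing by `r` gives the constant 3. -/
theorem normRdual_gradient_sub_le (hL : L ∈ H) (hLp : PosDef L) (hf : IsWeightedSmooth f L)
    {x x' : X} {r : ℝ} (h : normR H (x - x') ≤ r) :
    normRdual H (∇ f x - ∇ f x') ≤ 3 * opTrace L * r := by
  have htL := hH.opTrace_nonneg_of_isPositive hLp.isPositive
  have key : ∀ r : ℝ, 0 < r → normR H (x - x') ≤ r →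
      normRdual H (∇ f x - ∇ f x') ≤ 3 * opTrace L * r := by
    intro r hr h
    refine hH.normRdual_le fun u hu => ?_
    have hru : normR H (r • u) ≤ r := by
      rw [hH.normR_smul, abs_of_pos hr]
      exact mul_le_of_le_one_right hr.le hu
    have h1 := abs_le.1 (hH.abs_bregman_le hL hLp hf (x := x + r • u) (x' := x) (r := r) (by
      rwa [add_sub_cancel_left]))
    have h2 := abs_le.1 (hH.abs_bregman_le hL hLp hf (x := x + r • u) (x' := x') (r := 2 * r) (by
      have := hH.normR_add_le (x - x') (r • u)
      have e : x + r • u - x' = x - x' + r • u := by abel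
      rw [e]
      linarith))
    have h3 := abs_le.1 (hH.abs_bregman_le hL hLp hf h)
    have e1 : ⟪∇ f x, x + r • u - x⟫_ℝ = r * ⟪∇ f x, u⟫_ℝ := by
      rw [add_sub_cancel_left, inner_smul_right]
    have e2 : ⟪∇ f x', x + r • u - x'⟫_ℝ = ⟪∇ f x', x - x'⟫_ℝ + r * ⟪∇ f x', u⟫_ℝ := by
      have e : x + r • u - x' = x - x' + r • u := by abel
      rw [e, inner_add_right, inner_smul_right]
    rw [e1] at h1
    rw [e2] at h2
    rw [inner_sub_left]
    refine le_of_mul_le_mul_left ?_ hr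
    nlinarith [h1.1, h1.2, h2.1, h2.2, h3.1, h3.2]
  refine le_of_forall_pos_le_add fun δ hδ => ?_
  have h0 : 0 ≤ r := (normR_nonneg _).trans h
  have h1 : 0 < δ / (3 * opTrace L + 1) := by positivity
  have h2 := key (r + δ / (3 * opTrace L + 1)) (by positivity) (by linarith)
  have h3 : 3 * opTrace L * (δ / (3 * opTrace L + 1)) ≤ δ := by
    rw [mul_div_assoc', div_le_iff₀ (by positivity)]
    nlinarith
  linarith

omit hH in
theorem mem_ballQ_iff (hD : D ≠ ⊤) {x : X} : x ∈ ballQ H D ↔ normR H x ≤ D.toReal := by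
  rw [ballQ, Set.mem_ofPred_eq, ENNReal.ofReal_le_iff_le_toReal hD]

/-- By duality the linear maximum over the ball is explicit. Because `(D⁻¹).toReal = 0` at `D = ⊤`,
one formula serves bounded and unbounded domains alike. -/
theorem gap_eq (hD : 0 < D) (f : X → ℝ) (x : X) :
    gap H D f x = (D⁻¹).toReal * ⟪∇ f x, x⟫_ℝ + normRdual H (∇ f x) := by
  rcases eq_or_ne D ⊤ with rfl | hD'
  · simp [gap]
  have hd : 0 < D.toReal := ENNReal.toReal_pos hD.ne' hD'
  obtain ⟨u, hu, hgu⟩ := hH.exists_inner_eq (∇ f x)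
  have hmax : IsGreatest ((fun y => ⟪∇ f x, x - y⟫_ℝ) '' ballQ H D)
      (⟪∇ f x, x⟫_ℝ + D.toReal * normRdual H (∇ f x)) := by
    constructor
    · refine ⟨(-D.toReal) • u, ?_, ?_⟩
      · rw [mem_ballQ_iff hD', hH.normR_smul, abs_neg, abs_of_pos hd]
        exact mul_le_of_le_one_right hd.le hu
      · simp only
        rw [inner_sub_right, inner_smul_right, hgu]; ring
    · rintro _ ⟨y, hy, rfl⟩
      rw [mem_ballQ_iff hD'] at hy
      have h1 := hH.inner_le (-y) (∇ f x)
      rw [hH.normR_neg, inner_neg_left, real_inner_comm] at h1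
      have h2 := mul_le_mul_of_nonneg_right hy (hH.normRdual_nonneg (∇ f x))
      simp only
      rw [inner_sub_right]
      linarith
  rw [gap, if_neg hD', hmax.csSup_eq, ENNReal.toReal_inv]
  field_simp

theorem gap_nonneg (hD : 0 < D) (f : X → ℝ) {x : X} (hx : x ∈ ballQ H D) : 0 ≤ gap H D f x := by
  rw [hH.gap_eq hD]
  rcases eq_or_ne D ⊤ with rfl | hD'
  · simpa using hH.normRdual_nonneg _
  have hd : 0 < D.toReal := ENNReal.toReal_pos hD.ne' hD'
  rw [mem_ballQ_iff hD'] at hx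
  have h1 := hH.inner_le (-x) (∇ f x)
  rw [hH.normR_neg, inner_neg_left, real_inner_comm] at h1
  have h2 := mul_le_mul_of_nonneg_right hx (hH.normRdual_nonneg (∇ f x))
  have h3 : (D⁻¹).toReal * ⟪∇ f x, x⟫_ℝ + normRdual H (∇ f x) =
      (⟪∇ f x, x⟫_ℝ + D.toReal * normRdual H (∇ f x)) / D.toReal := by
    rw [ENNReal.toReal_inv]
    field_simp
  rw [h3]
  exact div_nonneg (by linarith) hd.le

omit hH [CompleteSpace X] in
theorem _root_.NonEuclideanSGD.IsWeightedSmooth.continuous_gradient [CompleteSpace X]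
    (hf : IsWeightedSmooth f L) :
    Continuous (fun x => ∇ f x) :=
  (InnerProductSpace.toDual ℝ X).symm.continuous.comp (hf.contDiff.continuous_fderiv one_ne_zero)

theorem continuous_gap (hD : 0 < D) (hf : IsWeightedSmooth f L) : Continuous (gap H D f) := by
  have h : gap H D f = fun x => (D⁻¹).toReal * ⟪∇ f x, x⟫_ℝ + normRdual H (∇ f x) :=
    funext fun x => hH.gap_eq hD f x
  rw [h]
  have := hf.continuous_gradient
  have h2 := hH.continuous_normRdual.comp this
  exact (continuous_const.mul (this.inner continuous_id)).add h2

theorem bddBelow_image_ballQ (hf : IsWeightedSmooth f L)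
    (hb : D = ⊤ → BddBelow (Set.range f)) : BddBelow (f '' ballQ H D) := by
  rcases eq_or_ne D ⊤ with hD | hD
  · exact (hb hD).mono (Set.image_subset_range _ _)
  · have hc : IsCompact (Metric.closedBall (0 : X) (√(opTrace (1 : X →L[ℝ] X)) * D.toReal)) :=
      isCompact_closedBall _ _
    refine (hc.bddBelow_image hf.contDiff.continuous.continuousOn).mono (Set.image_mono ?_)
    intro x hx
    rw [mem_ballQ_iff hD] at hx
    rw [mem_closedBall_zero_iff]
    exact (hH.norm_le x).trans (mul_le_mul_of_nonneg_left hx (Real.sqrt_nonneg _))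

theorem optValue_le (hf : IsWeightedSmooth f L) (hb : D = ⊤ → BddBelow (Set.range f)) {x : X}
    (hx : x ∈ ballQ H D) : optValue H D f ≤ f x :=
  csInf_le (hH.bddBelow_image_ballQ hf hb) (Set.mem_image_of_mem f hx)

-- Along `x + t (y - x)` the Bregman remainder is of order `t²`; after convexity is applied and `t`
-- divided out, it vanishes as `t → 0`.
omit [CompleteSpace X] hH in
theorem _root_.NonEuclideanSGD.IsWeightedSmooth.sub_le_inner [CompleteSpace X]
    (hf : IsWeightedSmooth f L) (hconv : ConvexOn ℝ Set.univ f) (x y : X) :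
    f x - f y ≤ ⟪∇ f x, x - y⟫_ℝ := by
  set w := wnormSq L (y - x) with hw
  have key : ∀ t : ℝ, 0 < t → t ≤ 1 → f x - f y ≤ ⟪∇ f x, x - y⟫_ℝ + t * (w / 2) := by
    intro t ht ht1
    have h1 := (abs_le.1 (hf.bregman (x + t • (y - x)) x)).1
    have h2 := hconv.2 (Set.mem_univ x) (Set.mem_univ y) (sub_nonneg.2 ht1) ht.le (by ring)
    have e1 : (1 - t) • x + t • y = x + t • (y - x) := by module
    have e2 : wnormSq L (t • (y - x)) = t ^ 2 * w := by
      rw [hw, wnormSq, wnormSq, map_smul, inner_smul_left, inner_smul_right]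
      simp only [conj_trivial]; ring
    have e3 : ⟪∇ f x, t • (y - x)⟫_ℝ = -(t * ⟪∇ f x, x - y⟫_ℝ) := by
      rw [inner_smul_right, ← neg_sub x y, inner_neg_right]; ring
    rw [e1, smul_eq_mul, smul_eq_mul] at h2
    rw [add_sub_cancel_left, e2, e3] at h1
    refine le_of_mul_le_mul_left ?_ ht
    nlinarith
  refine le_of_forall_pos_le_add fun δ hδ => ?_
  have hwp : 0 ≤ |w| := abs_nonneg w
  have h := key (min 1 (δ / (|w| + 1))) (by positivity) (min_le_left _ _)
  have h2 : min 1 (δ / (|w| + 1)) * (w / 2) ≤ δ := by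
    calc min 1 (δ / (|w| + 1)) * (w / 2) ≤ min 1 (δ / (|w| + 1)) * (|w| + 1) := by
          gcongr
          linarith [le_abs_self w]
      _ ≤ δ / (|w| + 1) * (|w| + 1) := by gcongr; exact min_le_right _ _
      _ = δ := by field_simp
  linarith

theorem sub_optValue_le_gap (hD : 0 < D) (hD' : D ≠ ⊤) (hf : IsWeightedSmooth f L)
    (hconv : ConvexOn ℝ Set.univ f) (x : X) : f x - optValue H D f ≤ D.toReal * gap H D f x := by
  have hd : 0 < D.toReal := ENNReal.toReal_pos hD.ne' hD'
  rw [sub_le_comm]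
  refine le_csInf ?_ ?_
  · refine Set.Nonempty.image f ⟨0, ?_⟩
    rw [mem_ballQ_iff hD', hH.normR_zero]
    exact hd.le
  · rintro _ ⟨y, hy, rfl⟩
    rw [mem_ballQ_iff hD'] at hy
    rw [sub_le_comm, hH.gap_eq hD, ENNReal.toReal_inv, mul_add, mul_inv_cancel_left₀ hd.ne']
    refine (hf.sub_le_inner hconv x y).trans ?_
    have h1 := hH.inner_le (-y) (∇ f x)
    rw [hH.normR_neg, inner_neg_left, real_inner_comm] at h1
    have h2 := mul_le_mul_of_nonneg_right hy (hH.normRdual_nonneg (∇ f x))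
    rw [inner_sub_right]
    linarith

/-! ### One step of the algorithm -/

variable {x x' m : X} {β η : ℝ}

theorem mul_normR_le (hη : 0 ≤ η) (hβη : β = η * (D⁻¹).toReal) (hD : 0 < D)
    (hx : x ∈ ballQ H D) : β * normR H x ≤ η := by
  rcases eq_or_ne D ⊤ with rfl | hD'
  · simpa [hβη] using hη
  · have hd : 0 < D.toReal := ENNReal.toReal_pos hD.ne' hD'
    rw [mem_ballQ_iff hD'] at hx
    rw [hβη, ENNReal.toReal_inv, mul_assoc]
    refine mul_le_of_le_one_right hη ?_
    rwa [inv_mul_le_iff₀ hd, mul_one]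

theorem mem_ballQ_of_step (hβη : β = η * (D⁻¹).toReal) (hβ1 : β ≤ 1) (hD : 0 < D)
    (hx : x ∈ ballQ H D) (hx' : normR H (x' - (1 - β) • x) ≤ η) : x' ∈ ballQ H D := by
  rcases eq_or_ne D ⊤ with rfl | hD'
  · simp [ballQ]
  · have hd : 0 < D.toReal := ENNReal.toReal_pos hD.ne' hD'
    have hη : η = β * D.toReal := by rw [hβη, ENNReal.toReal_inv]; field_simp
    rw [mem_ballQ_iff hD'] at hx ⊢
    have h1 := hH.normR_add_le (x' - (1 - β) • x) ((1 - β) • x)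
    rw [sub_add_cancel, hH.normR_smul, abs_of_nonneg (sub_nonneg.2 hβ1)] at h1
    have h2 := mul_le_mul_of_nonneg_left hx (sub_nonneg.2 hβ1)
    linarith

theorem normR_step_le (hη : 0 ≤ η) (hβη : β = η * (D⁻¹).toReal) (hD : 0 < D)
    (hx : x ∈ ballQ H D) (hx' : normR H (x' - (1 - β) • x) ≤ η) :
    normR H (x' - x) ≤ 2 * η := by
  have hβ : 0 ≤ β := by rw [hβη]; positivity
  have h1 := hH.normR_add_le (x' - (1 - β) • x) ((-β) • x)
  have e : x' - (1 - β) • x + (-β) • x = x' - x := by module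
  rw [e, hH.normR_smul, abs_neg, abs_of_nonneg hβ] at h1
  have h2 := hH.mul_normR_le hη hβη hD hx
  linarith

theorem descent (hL : L ∈ H) (hLp : PosDef L) (hf : IsWeightedSmooth f L)
    (hη : 0 ≤ η) (hβη : β = η * (D⁻¹).toReal) (hD : 0 < D)
    (hx : x ∈ ballQ H D) (hx' : normR H (x' - (1 - β) • x) ≤ η)
    (hmin : ∀ y : X, normR H (y - (1 - β) • x) ≤ η → ⟪m, x' - x⟫_ℝ ≤ ⟪m, y - x⟫_ℝ) :
    f x' ≤ f x - η * gap H D f x + 2 * η * normRdual H (m - ∇ f x) + 2 * opTrace L * η ^ 2 := by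
  obtain ⟨u, hu, hgu⟩ := hH.exists_inner_eq (∇ f x)
  have h1 := (abs_le.1 (hH.abs_bregman_le hL hLp hf (hH.normR_step_le hη hβη hD hx hx'))).2
  have hRu : normR H ((-η) • u) ≤ η := by
    rw [hH.normR_smul, abs_neg, abs_of_nonneg hη]
    exact mul_le_of_le_one_right hη hu
  -- The competitor moves against the dual maximizer `u` of the true gradient; its linear term is
  -- exactly `-η · gap`.
  have h2 := hmin ((1 - β) • x + (-η) • u) (by rwa [add_sub_cancel_left])
  have e1 : (1 - β) • x + (-η) • u - x = (-β) • x + (-η) • u := by module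
  have e2 : ∀ v : X, ⟪v, (-β) • x + (-η) • u⟫_ℝ = -(β * ⟪v, x⟫_ℝ) - η * ⟪v, u⟫_ℝ := fun v => by
    rw [inner_add_right, inner_smul_right, inner_smul_right]; ring
  rw [e1] at h2
  -- Competitor and new iterate both lie within `η` of `(1 - β) x`, hence the factor `2 η` on the
  -- momentum error.
  have h3 : ⟪m - ∇ f x, (-β) • x + (-η) • u - (x' - x)⟫_ℝ ≤ 2 * η * normRdual H (m - ∇ f x) := by
    rw [real_inner_comm]
    refine (hH.inner_le _ _).trans (mul_le_mul_of_nonneg_right ?_ (hH.normRdual_nonneg _))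
    have h4 := hH.normR_add_le ((-η) • u) (-(x' - (1 - β) • x))
    have e3 : (-η) • u + -(x' - (1 - β) • x) = (-β) • x + (-η) • u - (x' - x) := by module
    rw [e3, hH.normR_neg] at h4
    linarith
  have h5 : η * gap H D f x = β * ⟪∇ f x, x⟫_ℝ + η * ⟪∇ f x, u⟫_ℝ := by
    rw [hH.gap_eq hD, hβη, hgu]; ring
  rw [inner_sub_right, inner_sub_left, inner_sub_left, e2 (∇ f x)] at h3
  linarith

end IsStructured

/-! ### Moments of the gradient noise -/

theorem continuous_wnormSq (W : X →L[ℝ] X) : Continuous (wnormSq W) :=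
  continuous_id.inner W.continuous

theorem wnormSq_add {W : X →L[ℝ] X} (hW : W.IsPositive) (a c : ℝ) (u v : X) :
    wnormSq W (a • u + c • v) =
      a ^ 2 * wnormSq W u + c ^ 2 * wnormSq W v + 2 * (a * c) * ⟪u, W v⟫_ℝ := by
  have h : ⟪v, W u⟫_ℝ = ⟪u, W v⟫_ℝ := by rw [← hW.inner_left_eq_inner_right, real_inner_comm]
  simp only [wnormSq, map_add, map_smul, inner_add_left, inner_add_right, inner_smul_left,
    inner_smul_right, conj_trivial, h]
  ring

theorem two_mul_abs_inner_le {W : X →L[ℝ] X} (hW : W.IsPositive) (u v : X) :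
    2 * |⟪u, W v⟫_ℝ| ≤ wnormSq W u + wnormSq W v := by
  have h1 := wnormSq_add hW 1 1 u v
  have h2 := wnormSq_add hW 1 (-1) u v
  have h3 : 0 ≤ wnormSq W ((1 : ℝ) • u + (1 : ℝ) • v) := inner_apply_nonneg hW _
  have h4 : 0 ≤ wnormSq W ((1 : ℝ) • u + (-1 : ℝ) • v) := inner_apply_nonneg hW _
  rcases abs_cases ⟪u, W v⟫_ℝ with h | h <;> linarith

section Noise

variable [MeasurableSpace X] [BorelSpace X] {Ξ Ω : Type*} [MeasurableSpace Ξ]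
  {𝒢 : MeasurableSpace Ω} [mΩ : MeasurableSpace Ω] {P : Measure Ω} [IsProbabilityMeasure P] {μ : Measure Ξ}
  [IsProbabilityMeasure μ] {f : X → ℝ} {g : X → Ξ → X} {S : X →L[ℝ] X}

/-- The fresh sample is independent of the pair `(y, N)`, so the joint law is a product and Fubini
reduces both claims to a fixed query point, where the oracle assumptions apply. -/
theorem noise_moments (hW : (Ring.inverse S).IsPositive) (hf : Continuous (fun x => ∇ f x))
    (hg : IsGradientOracle f g μ S) (h𝒢 : 𝒢 ≤ mΩ) {y N : Ω → X}
    {ζ : Ω → Ξ} (hy : Measurable[𝒢] y) (hN : Measurable[𝒢] N) (hζ : Measurable ζ)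
    (hlaw : P.map ζ = μ) (hind : Indep (MeasurableSpace.comap ζ inferInstance) 𝒢 P)
    (hNi : Integrable (fun ω => wnormSq (Ring.inverse S) (N ω)) P) :
    (Integrable (fun ω => wnormSq (Ring.inverse S) (g (y ω) (ζ ω) - ∇ f (y ω))) P ∧
      ∫ ω, wnormSq (Ring.inverse S) (g (y ω) (ζ ω) - ∇ f (y ω)) ∂P ≤ opTrace S) ∧
    (Integrable (fun ω => ⟪N ω, Ring.inverse S (g (y ω) (ζ ω) - ∇ f (y ω))⟫_ℝ) P ∧
      ∫ ω, ⟪N ω, Ring.inverse S (g (y ω) (ζ ω) - ∇ f (y ω))⟫_ℝ ∂P = 0) := by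
  set W := Ring.inverse S with hWdef
  have hy' : Measurable y := hy.mono h𝒢 le_rfl
  have hN' : Measurable N := hN.mono h𝒢 le_rfl
  let Z : Ω → X × X := fun ω => (y ω, N ω)
  have hZ : Measurable Z := hy'.prodMk hN'
  have hZ𝒢 : Measurable[𝒢] Z := hy.prodMk hN
  have hindZ : IndepFun Z ζ P := by
    rw [IndepFun_iff_Indep]
    exact indep_of_indep_of_le_left hind.symm hZ𝒢.comap_le
  set ν := P.map Z with hν
  have : IsProbabilityMeasure ν := Measure.isProbabilityMeasure_map hZ.aemeasurable
  have hT : Measurable fun ω => (Z ω, ζ ω) := hZ.prodMk hζ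
  have hprod : P.map (fun ω => (Z ω, ζ ω)) = ν.prod μ := by
    rw [(indepFun_iff_map_prod_eq_prod_map_map hZ.aemeasurable hζ.aemeasurable).1 hindZ, hlaw]
  let n : (X × X) × Ξ → X := fun p => g p.1.1 p.2 - ∇ f p.1.1
  have hn : Measurable n :=
    (hg.measurable.comp ((measurable_fst.comp measurable_fst).prodMk measurable_snd)).sub
      (hf.measurable.comp (measurable_fst.comp measurable_fst))
  have hF : Measurable fun p => wnormSq W (n p) := (continuous_wnormSq W).measurable.comp hn
  have hFi : Integrable (fun p => wnormSq W (n p)) (ν.prod μ) := by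
    rw [integrable_prod_iff hF.aestronglyMeasurable]
    refine ⟨Filter.Eventually.of_forall fun p => hg.integrable_noise p.1, ?_⟩
    refine Integrable.mono' (integrable_const (opTrace S))
      hF.norm.stronglyMeasurable.integral_prod_right'.aestronglyMeasurable
      (Filter.Eventually.of_forall fun p => ?_)
    have e : ∀ z, ‖wnormSq W (n (p, z))‖ = wnormSq W (g p.1 z - ∇ f p.1) := fun z =>
      Real.norm_of_nonneg (inner_apply_nonneg hW _)
    simp only [e]
    have h0 : 0 ≤ ∫ z, wnormSq W (g p.1 z - ∇ f p.1) ∂μ :=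
      integral_nonneg fun z => inner_apply_nonneg hW _
    rw [Real.norm_of_nonneg h0]
    exact hg.variance_le p.1
  have hFle : ∫ p, wnormSq W (n p) ∂(ν.prod μ) ≤ opTrace S := by
    rw [integral_prod _ hFi]
    calc ∫ p, ∫ z, wnormSq W (n (p, z)) ∂μ ∂ν ≤ ∫ p, opTrace S ∂ν :=
          integral_mono hFi.integral_prod_left (integrable_const _) fun p => hg.variance_le p.1
      _ = opTrace S := by simp
  have hNν : Integrable (fun p : (X × X) × Ξ => wnormSq W p.1.2) (ν.prod μ) := by
    have h1 : Integrable (fun p : X × X => wnormSq W p.2) ν := by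
      have h2 : Measurable fun p : X × X => wnormSq W p.2 :=
        (continuous_wnormSq W).measurable.comp measurable_snd
      rw [hν, integrable_map_measure h2.aestronglyMeasurable hZ.aemeasurable]
      exact hNi
    exact h1.comp_fst μ
  have hG : Measurable fun p : (X × X) × Ξ => ⟪p.1.2, W (n p)⟫_ℝ :=
    (measurable_snd.comp measurable_fst).inner (W.continuous.measurable.comp hn)
  have hGi : Integrable (fun p : (X × X) × Ξ => ⟪p.1.2, W (n p)⟫_ℝ) (ν.prod μ) := by
    refine (hNν.add hFi).mono' hG.aestronglyMeasurable (Filter.Eventually.of_forall fun p => ?_)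
    have h1 := two_mul_abs_inner_le hW p.1.2 (n p)
    have h2 : 0 ≤ |⟪p.1.2, W (n p)⟫_ℝ| := abs_nonneg _
    simp only [Pi.add_apply, Real.norm_eq_abs]
    linarith
  have hG0 : ∫ p, ⟪p.1.2, W (n p)⟫_ℝ ∂(ν.prod μ) = 0 := by
    rw [integral_prod _ hGi]
    have h0 : ∀ p : X × X, ∫ z, ⟪p.2, W (n (p, z))⟫_ℝ ∂μ = 0 := fun p => by
      have hi : Integrable (fun z => g p.1 z - ∇ f p.1) μ :=
        (hg.integrable p.1).sub (integrable_const _)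
      have h1 : ∫ z, (g p.1 z - ∇ f p.1) ∂μ = 0 := by
        rw [integral_sub (hg.integrable p.1) (integrable_const _), hg.unbiased]; simp
      have h2 := ((innerSL ℝ p.2).comp W).integral_comp_comm hi
      rw [h1, map_zero] at h2
      exact h2
    simp [h0]
  refine ⟨⟨?_, ?_⟩, ?_, ?_⟩
  · rw [← hprod] at hFi
    exact hFi.comp_measurable hT
  · rw [← hprod, integral_map hT.aemeasurable hF.aestronglyMeasurable] at hFle
    exact hFle
  · rw [← hprod] at hGi
    exact hGi.comp_measurable hT
  · rw [← hprod, integral_map hT.aemeasurable hG.aestronglyMeasurable] at hG0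
    exact hG0

/-- The noise accumulated in the momentum. -/
def accNoise (f : X → ℝ) (g : X → Ξ → X) (α : ℝ) (x : ℕ → Ω → X) (ξ : ℕ → Ω → Ξ) : ℕ → Ω → X
  | 0 => fun ω => g (x 0 ω) (ξ 0 ω) - ∇ f (x 0 ω)
  | k + 1 => fun ω => (1 - α) • accNoise f g α x ξ k ω +
      α • (g (x (k + 1) ω) (ξ (k + 1) ω) - ∇ f (x (k + 1) ω))

/-! ### The momentum error along a run. -/

namespace IsRun

variable {H : Submodule ℝ (X →L[ℝ] X)} {L : X →L[ℝ] X} {x₀ : X} {α β η : ℝ} {K : ℕ}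
  {ℱ : Filtration ℕ mΩ} {ξ : ℕ → Ω → Ξ} {x m : ℕ → Ω → X} {D : ℝ≥0∞}

theorem measurable_iterate (hrun : IsRun H g μ x₀ α β η K P ℱ ξ x m) {k : ℕ} (hk : k ≤ K) :
    Measurable[ℱ k] (x k) := by
  cases k with
  | zero =>
    have : x 0 = fun _ => x₀ := funext hrun.x_zero
    rw [this]
    exact measurable_const
  | succ k => exact (hrun.x_measurable k hk).mono (ℱ.mono (Nat.le_succ k)) le_rfl

theorem measurable_accNoise (hrun : IsRun H g μ x₀ α β η K P ℱ ξ x m)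
    (hf : Continuous (fun x => ∇ f x)) (hg : IsGradientOracle f g μ S) {k : ℕ} (hk : k ≤ K) :
    Measurable[ℱ k] (accNoise f g α x ξ k) := by
  have hnoise : ∀ j ≤ K, Measurable[ℱ j] fun ω => g (x j ω) (ξ j ω) - ∇ f (x j ω) := fun j hj =>
    (hg.measurable.comp ((hrun.measurable_iterate hj).prodMk (hrun.sample_measurable j hj))).sub
      (hf.measurable.comp (hrun.measurable_iterate hj))
  induction k with
  | zero => exact hnoise 0 hk
  | succ k ih =>
    exact (((ih (by omega)).mono (ℱ.mono (Nat.le_succ k)) le_rfl).const_smul (1 - α)).add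
      ((hnoise (k + 1) hk).const_smul α)

/-- The cross term has mean zero, so the squares add; the bound propagates since `(1 - α)² α + α² ≤
α`. The term `(1 - α)^k` is the memory of the first sample, which enters with weight one. -/
theorem accNoise_moment (hrun : IsRun H g μ x₀ α β η K P ℱ ξ x m)
    (hW : (Ring.inverse S).IsPositive) (hS0 : 0 ≤ opTrace S) (hα0 : 0 ≤ α) (hα1 : α ≤ 1)
    (hf : Continuous (fun x => ∇ f x)) (hg : IsGradientOracle f g μ S) {k : ℕ} (hk : k ≤ K) :
    Integrable (fun ω => wnormSq (Ring.inverse S) (accNoise f g α x ξ k ω)) P ∧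
      ∫ ω, wnormSq (Ring.inverse S) (accNoise f g α x ξ k ω) ∂P ≤
        opTrace S * (((1 - α) ^ k) ^ 2 + α) := by
  induction k with
  | zero =>
    have hx0 : x 0 = fun _ => x₀ := funext hrun.x_zero
    -- The initial point is deterministic, so the trivial σ-algebra serves as the past.
    have h := (noise_moments (P := P) (𝒢 := ⊥) hW hf hg bot_le (y := fun _ => x₀) (N := fun _ => 0)
      (ζ := ξ 0) measurable_const measurable_const
      ((hrun.sample_measurable 0 hk).mono (ℱ.le 0) le_rfl) (hrun.sample_law 0 hk)
      (indep_bot_right _) (by simp [wnormSq])).1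
    simp only [accNoise, hx0]
    refine ⟨h.1, h.2.trans ?_⟩
    simp only [pow_zero, one_pow]
    nlinarith
  | succ k ih =>
    obtain ⟨ihi, ihb⟩ := ih (by omega)
    obtain ⟨⟨h1, h2⟩, h3, h4⟩ := noise_moments (P := P) hW hf hg (ℱ.le k)
      (hrun.x_measurable k hk) (hrun.measurable_accNoise hf hg (by omega))
      ((hrun.sample_measurable (k + 1) hk).mono (ℱ.le _) le_rfl) (hrun.sample_law (k + 1) hk)
      (hrun.sample_indep k hk) ihi
    simp only [accNoise, wnormSq_add hW]
    have i1 : Integrable (fun ω => (1 - α) ^ 2 * wnormSq (Ring.inverse S) (accNoise f g α x ξ k ω) +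
        α ^ 2 * wnormSq (Ring.inverse S)
          (g (x (k + 1) ω) (ξ (k + 1) ω) - ∇ f (x (k + 1) ω))) P :=
      (ihi.const_mul ((1 - α) ^ 2)).add (h1.const_mul (α ^ 2))
    refine ⟨i1.add (h3.const_mul _), ?_⟩
    rw [integral_add i1 (h3.const_mul _),
      integral_add (ihi.const_mul ((1 - α) ^ 2)) (h1.const_mul (α ^ 2)), integral_const_mul,
      integral_const_mul, integral_const_mul, h4, mul_zero, add_zero]
    have h5 := mul_le_mul_of_nonneg_left ihb (sq_nonneg (1 - α))
    have h6 := mul_le_mul_of_nonneg_left h2 (sq_nonneg α)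
    have h7 : opTrace S * (((1 - α) ^ (k + 1)) ^ 2 + α) - ((1 - α) ^ 2 *
        (opTrace S * (((1 - α) ^ k) ^ 2 + α)) + α ^ 2 * opTrace S) =
        opTrace S * (α ^ 2 * (1 - α)) := by ring
    have h8 : 0 ≤ opTrace S * (α ^ 2 * (1 - α)) :=
      mul_nonneg hS0 (mul_nonneg (sq_nonneg α) (by linarith))
    linarith

theorem mem_ballQ (hrun : IsRun H g μ x₀ α β η K P ℱ ξ x m) (hH : IsStructured H)
    (hβη : β = η * (D⁻¹).toReal) (hβ1 : β ≤ 1) (hD : 0 < D) (hx₀ : x₀ ∈ ballQ H D) {k : ℕ}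
    (hk : k ≤ K) (ω : Ω) : x k ω ∈ ballQ H D := by
  induction k with
  | zero => rwa [hrun.x_zero]
  | succ k ih => exact hH.mem_ballQ_of_step hβη hβ1 hD (ih (by omega)) (hrun.x_feasible k hk ω)

/-- With the noise removed, the error obeys `d ↦ (1 - α)(d + gradient change)`, each change being at
most `6 tr(L) η`. The geometric sum gives a bound for every outcome. -/
theorem normRdual_drift_le (hrun : IsRun H g μ x₀ α β η K P ℱ ξ x m) (hH : IsStructured H)
    (hL : L ∈ H) (hLp : PosDef L) (hf : IsWeightedSmooth f L) (hα0 : 0 < α) (hα1 : α ≤ 1)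
    (hη : 0 ≤ η) (hβη : β = η * (D⁻¹).toReal) (hβ1 : β ≤ 1) (hD : 0 < D) (hx₀ : x₀ ∈ ballQ H D)
    {k : ℕ} (hk : k ≤ K) (ω : Ω) :
    normRdual H (m k ω - ∇ f (x k ω) - accNoise f g α x ξ k ω) ≤ 6 * opTrace L * η / α := by
  have htL := hH.opTrace_nonneg_of_isPositive hLp.isPositive
  induction k with
  | zero =>
    have : m 0 ω - ∇ f (x 0 ω) - accNoise f g α x ξ 0 ω = 0 := by
      simp [accNoise, hrun.m_zero, hrun.x_zero]
    rw [this, hH.normRdual_zero]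
    positivity
  | succ k ih =>
    have ih := ih (by omega)
    have hstep := hH.normR_step_le hη hβη hD
      (hrun.mem_ballQ hH hβη hβ1 hD hx₀ (by omega : k ≤ K) ω) (hrun.x_feasible k hk ω)
    rw [← hH.normR_neg, neg_sub] at hstep
    have hgrad := hH.normRdual_gradient_sub_le hL hLp hf hstep
    have e : m (k + 1) ω - ∇ f (x (k + 1) ω) - accNoise f g α x ξ (k + 1) ω =
        (1 - α) • ((m k ω - ∇ f (x k ω) - accNoise f g α x ξ k ω) +
          (∇ f (x k ω) - ∇ f (x (k + 1) ω))) := by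
      rw [hrun.m_step k hk, accNoise]
      module
    rw [e, hH.normRdual_smul, abs_of_nonneg (sub_nonneg.2 hα1)]
    calc (1 - α) * normRdual H _ ≤ (1 - α) * (6 * opTrace L * η / α + 3 * opTrace L * (2 * η)) := by
          refine mul_le_mul_of_nonneg_left ?_ (sub_nonneg.2 hα1)
          exact (hH.normRdual_add_le _ _).trans (add_le_add ih hgrad)
      _ = 6 * opTrace L * η / α - α * (6 * opTrace L * η) := by field_simp; ring
      _ ≤ 6 * opTrace L * η / α := by
          have : 0 ≤ α * (6 * opTrace L * η) := by positivity
          linarith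

/-- An integrable bound on the error of the momentum. -/
theorem exists_error_bound (hrun : IsRun H g μ x₀ α β η K P ℱ ξ x m) (hH : IsStructured H)
    (hL : L ∈ H) (hLp : PosDef L) (hSH : S ∈ H) (hS : PosDef S) (hf : IsWeightedSmooth f L)
    (hg : IsGradientOracle f g μ S) (hα0 : 0 < α) (hα1 : α ≤ 1)
    (hη : 0 ≤ η) (hβη : β = η * (D⁻¹).toReal) (hβ1 : β ≤ 1) (hD : 0 < D) (hx₀ : x₀ ∈ ballQ H D)
    {k : ℕ} (hk : k ≤ K) :
    ∃ B : Ω → ℝ, Integrable B P ∧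
      ∫ ω, B ω ∂P ≤ 6 * opTrace L * η / α + opTrace S * ((1 - α) ^ k + √α) ∧
      ∀ ω, normRdual H (m k ω - ∇ f (x k ω)) ≤ B ω := by
  have hS0 := hH.opTrace_nonneg_of_isPositive hS.isPositive
  have hpow : 0 ≤ (1 - α) ^ k := pow_nonneg (sub_nonneg.2 hα1) k
  have hsqrt := Real.sqrt_pos.2 hα0
  obtain ⟨hi, hb⟩ := hrun.accNoise_moment (hH.isPositive_inverse hSH hS) hS0 hα0.le hα1
    hf.continuous_gradient hg hk
  -- This scale satisfies `s² ≥ (1 - α)^(2k) + α`, so both halves of `two_mul_normRdual_le`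
  -- contribute at most `tr(S) s / 2` in mean.
  set s := (1 - α) ^ k + √α with hs
  have hs0 : 0 < s := by positivity
  have hi2 := (hi.const_mul s⁻¹).const_mul (1 / 2)
  refine ⟨fun ω => (6 * opTrace L * η / α + 1 / 2 * (s * opTrace S)) +
    1 / 2 * (s⁻¹ * wnormSq (Ring.inverse S) (accNoise f g α x ξ k ω)),
    (integrable_const _).add hi2, ?_, fun ω => ?_⟩
  · rw [integral_add (integrable_const _) hi2, integral_const_mul, integral_const_mul]
    have h1 : opTrace S * (((1 - α) ^ k) ^ 2 + α) ≤ opTrace S * s ^ 2 := by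
      refine mul_le_mul_of_nonneg_left ?_ hS0
      rw [hs, add_sq, Real.sq_sqrt hα0.le]
      have : 0 ≤ 2 * (1 - α) ^ k * √α := by positivity
      linarith
    have h2 : s⁻¹ * ∫ ω, wnormSq (Ring.inverse S) (accNoise f g α x ξ k ω) ∂P ≤ opTrace S * s := by
      rw [inv_mul_le_iff₀ hs0]
      linarith
    simp only [integral_const, probReal_univ, one_smul]
    linarith
  · have h1 := hrun.normRdual_drift_le hH hL hLp hf hα0 hα1 hη hβη hβ1 hD hx₀ hk ω
    have h2 := hH.two_mul_normRdual_le hSH hS hs0 (accNoise f g α x ξ k ω)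
    have h3 := hH.normRdual_add_le (m k ω - ∇ f (x k ω) - accNoise f g α x ξ k ω)
      (accNoise f g α x ξ k ω)
    rw [sub_add_cancel] at h3
    linarith

theorem descent (hrun : IsRun H g μ x₀ α β η K P ℱ ξ x m) (hH : IsStructured H)
    (hL : L ∈ H) (hLp : PosDef L) (hf : IsWeightedSmooth f L)
    (hη : 0 ≤ η) (hβη : β = η * (D⁻¹).toReal) (hβ1 : β ≤ 1) (hD : 0 < D) (hx₀ : x₀ ∈ ballQ H D)
    {k : ℕ} (hk : k < K) (ω : Ω) :
    f (x (k + 1) ω) ≤ f (x k ω) - η * gap H D f (x k ω) +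
      2 * η * normRdual H (m k ω - ∇ f (x k ω)) + 2 * opTrace L * η ^ 2 :=
  hH.descent hL hLp hf hη hβη hD (hrun.mem_ballQ hH hβη hβ1 hD hx₀ hk.le ω)
    (hrun.x_feasible k hk ω) (hrun.x_minimal k hk ω)

end IsRun

end Noise

/-! ### Convergence for general parameters -/

section Rates

variable [MeasurableSpace X] [BorelSpace X] {Ξ Ω : Type*} [MeasurableSpace Ξ]
  [mΩ : MeasurableSpace Ω] {P : Measure Ω} [IsProbabilityMeasure P] {μ : Measure Ξ}
  [IsProbabilityMeasure μ] {f : X → ℝ} {g : X → Ξ → X} {L S : X →L[ℝ] X}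
  {H : Submodule ℝ (X →L[ℝ] X)} {x₀ : X} {α β η : ℝ} {K : ℕ}
  {ℱ : Filtration ℕ mΩ} {ξ : ℕ → Ω → Ξ} {x m : ℕ → Ω → X} {D : ℝ≥0∞}

theorem sum_pow_one_sub_le (hα0 : 0 < α) (hα1 : α ≤ 1) (K : ℕ) :
    ∑ k ∈ Finset.range K, (1 - α) ^ k ≤ 1 / α := by
  have h := mul_neg_geom_sum (1 - α) K
  have h1 : 0 ≤ (1 - α) ^ K := pow_nonneg (sub_nonneg.2 hα1) K
  rw [le_div_iff₀ hα0]
  rw [sub_sub_cancel] at h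
  linarith

/-- The descent inequalities telescope, and the smallest gap is at most the average. The transient
noise sums to at most `tr(S) / α`, so it costs only `2 tr(S) / (α K)`. -/
theorem IsRun.integral_iInf_gap_le (hrun : IsRun H g μ x₀ α β η K P ℱ ξ x m) (hH : IsStructured H)
    (hL : L ∈ H) (hLp : PosDef L) (hSH : S ∈ H) (hS : PosDef S) (hf : IsWeightedSmooth f L)
    (hg : IsGradientOracle f g μ S) (hb : D = ⊤ → BddBelow (Set.range f)) (hα0 : 0 < α)
    (hα1 : α ≤ 1) (hη : 0 < η) (hβη : β = η * (D⁻¹).toReal) (hβ1 : β ≤ 1) (hD : 0 < D)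
    (hx₀ : x₀ ∈ ballQ H D) (hK : 0 < K) :
    Integrable (fun ω => ⨅ k : Fin K, gap H D f (x k ω)) P ∧
      ∫ ω, (⨅ k : Fin K, gap H D f (x k ω)) ∂P ≤
        (f x₀ - optValue H D f) / (η * K) + 2 * opTrace L * η + 12 * opTrace L * η / α +
          2 * opTrace S / (α * K) + 2 * opTrace S * √α := by
  have hS0 := hH.opTrace_nonneg_of_isPositive hS.isPositive
  have hne : Nonempty (Fin K) := ⟨⟨0, hK⟩⟩
  have hKr : (0 : ℝ) < K := Nat.cast_pos.2 hK
  have hmem : ∀ k ≤ K, ∀ ω, x k ω ∈ ballQ H D := fun k hk ω =>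
    hrun.mem_ballQ hH hβη hβ1 hD hx₀ hk ω
  have hmeas : ∀ k : Fin K, Measurable fun ω => gap H D f (x k ω) := fun k =>
    (hH.continuous_gap hD hf).measurable.comp
      ((hrun.measurable_iterate k.2.le).mono (ℱ.le _) le_rfl)
  have hgap0 : ∀ ω, ∀ k : Fin K, 0 ≤ gap H D f (x k ω) := fun ω k =>
    hH.gap_nonneg hD f (hmem k k.2.le ω)
  have hbdd : ∀ ω, BddBelow (Set.range fun k : Fin K => gap H D f (x k ω)) := fun ω =>
    ⟨0, by rintro _ ⟨k, rfl⟩; exact hgap0 ω k⟩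
  have hint : Integrable (fun ω => ⨅ k : Fin K, gap H D f (x k ω)) P := by
    refine Integrable.mono' (integrable_const (gap H D f x₀))
      (Measurable.iInf hmeas).aestronglyMeasurable (Filter.Eventually.of_forall fun ω => ?_)
    rw [Real.norm_of_nonneg (le_ciInf (hgap0 ω))]
    refine (ciInf_le (hbdd ω) ⟨0, hK⟩).trans ?_
    rw [hrun.x_zero]
  refine ⟨hint, ?_⟩
  have hB : ∀ k, ∃ B : Ω → ℝ, k ≤ K → Integrable B P ∧
      ∫ ω, B ω ∂P ≤ 6 * opTrace L * η / α + opTrace S * ((1 - α) ^ k + √α) ∧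
      ∀ ω, normRdual H (m k ω - ∇ f (x k ω)) ≤ B ω := fun k => by
    by_cases hk : k ≤ K
    · obtain ⟨B, h⟩ := hrun.exists_error_bound hH hL hLp hSH hS hf hg hα0 hα1 hη.le hβη hβ1 hD hx₀ hk
      exact ⟨B, fun _ => h⟩
    · exact ⟨0, fun h => absurd h hk⟩
  choose B hB using hB
  have hBi : Integrable (fun ω => ∑ k ∈ Finset.range K, B k ω) P :=
    integrable_finsetSum _ fun k hk => (hB k (Finset.mem_range.1 hk).le).1
  have hpoint : ∀ ω, ⨅ k : Fin K, gap H D f (x k ω) ≤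
      ((f x₀ - optValue H D f) / (η * K) + 2 * opTrace L * η) +
        2 / K * ∑ k ∈ Finset.range K, B k ω := by
    intro ω
    set G := ⨅ k : Fin K, gap H D f (x k ω)
    have h1 : ∑ k ∈ Finset.range K, η * G ≤ ∑ k ∈ Finset.range K,
        ((f (x k ω) - f (x (k + 1) ω)) + (2 * η * B k ω + 2 * opTrace L * η ^ 2)) := by
      refine Finset.sum_le_sum fun k hk => ?_
      rw [Finset.mem_range] at hk
      have h2 := hrun.descent hH hL hLp hf hη.le hβη hβ1 hD hx₀ hk ω
      have h3 := mul_le_mul_of_nonneg_left ((hB k hk.le).2.2 ω) (by positivity : 0 ≤ 2 * η)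
      have h4 := mul_le_mul_of_nonneg_left (ciInf_le (hbdd ω) ⟨k, hk⟩) hη.le
      simp only at h4
      linarith
    rw [Finset.sum_add_distrib, Finset.sum_range_sub', Finset.sum_add_distrib, ← Finset.mul_sum,
      ← Finset.mul_sum, Finset.sum_const, Finset.sum_const, Finset.card_range, hrun.x_zero, nsmul_eq_mul,
      nsmul_eq_mul] at h1
    have h5 := hH.optValue_le hf hb (hmem K le_rfl ω)
    have h6 : ((f x₀ - optValue H D f) / (η * K) + 2 * opTrace L * η) +
        2 / K * ∑ k ∈ Finset.range K, B k ω =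
        ((f x₀ - optValue H D f) + (2 * η * ∑ k ∈ Finset.range K, B k ω +
          K * (2 * opTrace L * η ^ 2))) / (K * η) := by
      field_simp
      ring
    rw [h6, le_div_iff₀ (by positivity)]
    linarith
  have hBi2 := hBi.const_mul (2 / (K : ℝ))
  refine (integral_mono hint ((integrable_const _).add hBi2) hpoint).trans ?_
  simp only [Pi.add_apply]
  rw [integral_add (integrable_const _) hBi2, integral_const_mul,
    integral_finsetSum _ fun k hk => (hB k (Finset.mem_range.1 hk).le).1]
  have h7 : ∑ k ∈ Finset.range K, ∫ ω, B k ω ∂P ≤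
      K * (6 * opTrace L * η / α) + opTrace S * (1 / α + K * √α) := by
    calc ∑ k ∈ Finset.range K, ∫ ω, B k ω ∂P ≤ ∑ k ∈ Finset.range K,
          (6 * opTrace L * η / α + opTrace S * ((1 - α) ^ k + √α)) :=
          Finset.sum_le_sum fun k hk => (hB k (Finset.mem_range.1 hk).le).2.1
      _ = K * (6 * opTrace L * η / α) +
          opTrace S * (∑ k ∈ Finset.range K, (1 - α) ^ k + K * √α) := by
          rw [Finset.sum_add_distrib, ← Finset.mul_sum, Finset.sum_add_distrib]
          simp
      _ ≤ _ := by
          have := sum_pow_one_sub_le hα0 hα1 K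
          gcongr
  have h8 := mul_le_mul_of_nonneg_left h7 (by positivity : (0 : ℝ) ≤ 2 / K)
  have h9 : 2 / (K : ℝ) * (K * (6 * opTrace L * η / α) + opTrace S * (1 / α + K * √α)) =
      12 * opTrace L * η / α + 2 * opTrace S / (α * K) + 2 * opTrace S * √α := by
    field_simp
    ring
  simp only [integral_const, probReal_univ, one_smul]
  linarith

/-- Descent and `f - f* ≤ D · gap` contract the error by `1 - β`, with forcing `β E + 2 η tr(S) (1 -
α)^k`. The rate is relaxed to `1 - β/2 ≥ 1 - α`: the slack `β/2` times `4 D tr(S)` equals `2 η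
tr(S)`, exactly what absorbs the transient. -/
theorem IsRun.integral_sub_optValue_le (hrun : IsRun H g μ x₀ α β η K P ℱ ξ x m)
    (hH : IsStructured H) (hL : L ∈ H) (hLp : PosDef L) (hSH : S ∈ H) (hS : PosDef S)
    (hf : IsWeightedSmooth f L) (hconv : ConvexOn ℝ Set.univ f)
    (hg : IsGradientOracle f g μ S) (hα0 : 0 < α) (hα1 : α ≤ 1) (hβ0 : 0 ≤ β) (hβα : β ≤ α)
    (hη : η = β * D.toReal) (hD : 0 < D) (hD' : D ≠ ⊤) (hx₀ : x₀ ∈ ballQ H D) {k : ℕ}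
    (hk : k ≤ K) :
    Integrable (fun ω => f (x k ω) - optValue H D f) P ∧
      ∫ ω, (f (x k ω) - optValue H D f) ∂P ≤
        (1 - β / 2) ^ k * (f x₀ - optValue H D f + 4 * D.toReal * opTrace S) +
          2 * D.toReal * (6 * opTrace L * η / α + opTrace S * √α + opTrace L * η) := by
  have hS0 := hH.opTrace_nonneg_of_isPositive hS.isPositive
  have hL0 := hH.opTrace_nonneg_of_isPositive hLp.isPositive
  have hd : 0 < D.toReal := ENNReal.toReal_pos hD.ne' hD'
  have hη0 : 0 ≤ η := by rw [hη]; positivity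
  have hβη : β = η * (D⁻¹).toReal := by rw [hη, ENNReal.toReal_inv]; field_simp
  have hβ1 : β ≤ 1 := hβα.trans hα1
  have hb : D = ⊤ → BddBelow (Set.range f) := fun h => absurd h hD'
  have hΔ : 0 ≤ f x₀ - optValue H D f := sub_nonneg.2 (hH.optValue_le hf hb hx₀)
  set E := 2 * D.toReal * (6 * opTrace L * η / α + opTrace S * √α + opTrace L * η) with hE
  have hE0 : 0 ≤ E := by positivity
  induction k with
  | zero =>
    have : x 0 = fun _ => x₀ := funext hrun.x_zero
    refine ⟨by rw [this]; exact integrable_const _, ?_⟩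
    have : 0 ≤ 4 * D.toReal * opTrace S := by positivity
    simp only [hrun.x_zero, integral_const, probReal_univ, one_smul, pow_zero, one_mul]
    linarith
  | succ k ih =>
    obtain ⟨ihi, ihb⟩ := ih (by omega)
    obtain ⟨B, hBi, hBle, hB⟩ := hrun.exists_error_bound hH hL hLp hSH hS hf hg hα0 hα1 hη0 hβη hβ1
      hD hx₀ (by omega : k ≤ K)
    have hstep : ∀ ω, f (x (k + 1) ω) - optValue H D f ≤
        ((1 - β) * (f (x k ω) - optValue H D f) + 2 * η * B ω) + 2 * opTrace L * η ^ 2 := by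
      intro ω
      have h1 := hrun.descent hH hL hLp hf hη0 hβη hβ1 hD hx₀ hk ω
      have h2 := mul_le_mul_of_nonneg_left (hB ω) (by positivity : 0 ≤ 2 * η)
      have h3 := mul_le_mul_of_nonneg_left (hH.sub_optValue_le_gap hD hD' hf hconv (x k ω)) hβ0
      have h4 : η * gap H D f (x k ω) = β * (D.toReal * gap H D f (x k ω)) := by rw [hη]; ring
      linarith
    have i1 : Integrable (fun ω => (1 - β) * (f (x k ω) - optValue H D f) + 2 * η * B ω) P :=
      (ihi.const_mul _).add (hBi.const_mul _)
    have i2 := i1.add (integrable_const (2 * opTrace L * η ^ 2))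
    have hmeas : Measurable fun ω => f (x (k + 1) ω) - optValue H D f :=
      (hf.contDiff.continuous.measurable.comp
        ((hrun.measurable_iterate hk).mono (ℱ.le _) le_rfl)).sub_const _
    have hi : Integrable (fun ω => f (x (k + 1) ω) - optValue H D f) P := by
      refine i2.mono' hmeas.aestronglyMeasurable (Filter.Eventually.of_forall fun ω => ?_)
      rw [Real.norm_of_nonneg]
      · exact hstep ω
      · exact sub_nonneg.2 (hH.optValue_le hf hb (hrun.mem_ballQ hH hβη hβ1 hD hx₀ hk ω))
    refine ⟨hi, (integral_mono hi i2 hstep).trans ?_⟩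
    simp only [Pi.add_apply]
    rw [integral_add i1 (integrable_const _), integral_add (ihi.const_mul _) (hBi.const_mul _),
      integral_const_mul, integral_const_mul]
    simp only [integral_const, probReal_univ, one_smul]
    have h1 := mul_le_mul_of_nonneg_left ihb (sub_nonneg.2 hβ1)
    have h2 := mul_le_mul_of_nonneg_left hBle (by positivity : 0 ≤ 2 * η)
    have hq : (1 - α) ^ k ≤ (1 - β / 2) ^ k :=
      pow_le_pow_left₀ (sub_nonneg.2 hα1) (by linarith) k
    have hq0 : 0 ≤ (1 - β / 2) ^ k := pow_nonneg (by linarith) k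
    have h3 := mul_le_mul_of_nonneg_left hq (by positivity : 0 ≤ 2 * η * opTrace S)
    have h4 : 2 * η * (6 * opTrace L * η / α + opTrace S * ((1 - α) ^ k + √α)) +
        2 * opTrace L * η ^ 2 = β * E + 2 * η * opTrace S * (1 - α) ^ k := by
      rw [hE, hη]; ring
    have h5 : (1 - β / 2) ^ (k + 1) * (f x₀ - optValue H D f + 4 * D.toReal * opTrace S) + E -
        ((1 - β) * ((1 - β / 2) ^ k * (f x₀ - optValue H D f + 4 * D.toReal * opTrace S) + E) +
          (β * E + 2 * η * opTrace S * (1 - β / 2) ^ k)) =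
        β / 2 * (1 - β / 2) ^ k * (f x₀ - optValue H D f) := by
      rw [hη]; ring
    have h6 : 0 ≤ β / 2 * (1 - β / 2) ^ k * (f x₀ - optValue H D f) := by positivity
    linarith

end Rates

/-! ### The choice of the parameters -/

theorem one_div_min_le {u v : ℝ} (hu : 0 < u) (hv : 0 < v) : 1 / min u v ≤ 1 / u + 1 / v := by
  have h1 : 0 < 1 / u := by positivity
  have h2 : 0 < 1 / v := by positivity
  rcases min_choice u v with h | h <;> rw [h] <;> linarith

theorem mul_sqrt_le {s c α : ℝ} (hs : 0 < s) (hc : 0 ≤ c) (h : α ≤ (c / s) ^ 2) : s * √α ≤ c := by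
  have h1 := Real.sqrt_le_sqrt h
  rw [Real.sqrt_sq (by positivity)] at h1
  calc s * √α ≤ s * (c / s) := by gcongr
    _ = c := by field_simp

/-- Here `δ` stands for `1 / D`, zero when `D = ∞`; the two bounds on `η` are all that both cases
share. -/
theorem nonconvex_rate {s t Δ ε δ α η K : ℝ} (hs : 0 < s) (ht : 0 < t) (hΔ : 0 ≤ Δ) (hε : 0 < ε)
    (hα : α = min 1 (1 / 100 * (ε ^ 2 / s ^ 2))) (hη : 0 < η)
    (hη1 : 1 / η ≤ δ + 100 * t / (ε * α)) (hη2 : η ≤ 1 / 100 * (ε * α / t))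
    (hK : 100000 * max 1 (max (Δ / ε * δ) (max (t * Δ / ε ^ 2)
      (max (s ^ 3 / ε ^ 3) (s ^ 2 * t * Δ / ε ^ 4)))) ≤ K) :
    Δ / (η * K) + 2 * t * η + 12 * t * η / α + 2 * s / (α * K) + 2 * s * √α ≤ ε := by
  have hα0 : 0 < α := by rw [hα]; positivity
  have hα1 : α ≤ 1 := hα ▸ min_le_left _ _
  have hinv : 1 / α ≤ 1 + 100 * s ^ 2 / ε ^ 2 := by
    rw [hα]
    refine (one_div_min_le one_pos (by positivity)).trans (le_of_eq ?_)
    field_simp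
  rw [mul_max_of_nonneg _ _ (by norm_num), mul_max_of_nonneg _ _ (by norm_num),
    mul_max_of_nonneg _ _ (by norm_num), mul_max_of_nonneg _ _ (by norm_num)] at hK
  simp only [max_le_iff] at hK
  obtain ⟨k1, k2, k3, k4, k5⟩ := hK
  have hK0 : 0 < K := by linarith
  have hsq : s * √α ≤ ε / 10 := by
    refine mul_sqrt_le hs (by positivity) ((hα ▸ min_le_right _ _ : α ≤ _).trans (le_of_eq ?_))
    field_simp
    norm_num
  have hte : t * η / α ≤ ε / 100 := by
    rw [div_le_iff₀ hα0]
    calc t * η ≤ t * (1 / 100 * (ε * α / t)) := by gcongr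
      _ = ε / 100 * α := by field_simp
  have hte2 : t * η ≤ t * η / α := by
    rw [le_div_iff₀ hα0]
    exact mul_le_of_le_one_right (by positivity) hα1
  have e1 : Δ / (η * K) ≤ 10101 / 100000 * ε := by
    have h1 : Δ / (η * K) = Δ * (1 / η) / K := by field_simp
    rw [h1, div_le_iff₀ hK0]
    have h2 : 100 * t / (ε * α) ≤ 100 * t / ε * (1 + 100 * s ^ 2 / ε ^ 2) := by
      calc 100 * t / (ε * α) = 100 * t / ε * (1 / α) := by field_simp
        _ ≤ _ := by gcongr
    have h3 : Δ * (1 / η) ≤ Δ * (δ + 100 * t / ε * (1 + 100 * s ^ 2 / ε ^ 2)) := by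
      gcongr
      linarith
    refine h3.trans ?_
    -- The weights 1, 100 and 10000 of the three terms give the constant 10101.
    have h4 : Δ * (δ + 100 * t / ε * (1 + 100 * s ^ 2 / ε ^ 2)) =
        ε / 100000 * (100000 * (Δ / ε * δ) + 100 * (100000 * (t * Δ / ε ^ 2)) +
          10000 * (100000 * (s ^ 2 * t * Δ / ε ^ 4))) := by
      field_simp
      ring
    rw [h4]
    calc _ ≤ ε / 100000 * (K + 100 * K + 10000 * K) := by gcongr
      _ = _ := by ring
  have e2 : 2 * s / (α * K) ≤ 1 / 100 * ε := by
    have h1 : 2 * s / (α * K) = 2 * s * (1 / α) / K := by field_simp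
    rw [h1, div_le_iff₀ hK0]
    have h2 : 100000 * s ≤ ε * K := by
      -- The maximum has no entry `s / ε`, but `s / ε ≤ max(1, s³/ε³)`.
      rcases le_total s ε with h | h
      · nlinarith
      · have h3 : s ≤ ε * (s ^ 3 / ε ^ 3) := by
          rw [mul_div_assoc', le_div_iff₀ (by positivity)]
          have : ε ^ 2 ≤ s ^ 2 := pow_le_pow_left₀ hε.le h 2
          calc s * ε ^ 3 = ε * s * ε ^ 2 := by ring
            _ ≤ ε * s * s ^ 2 := by gcongr
            _ = _ := by ring
        have := mul_le_mul_of_nonneg_left k4 hε.le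
        linarith
    have h5 : 2 * s * (1 / α) ≤ 2 * s * (1 + 100 * s ^ 2 / ε ^ 2) := by gcongr
    have h6 : 2 * s * (1 + 100 * s ^ 2 / ε ^ 2) =
        2 * s + 200 * ε / 100000 * (100000 * (s ^ 3 / ε ^ 3)) := by field_simp; ring
    have h7 : 200 * ε / 100000 * (100000 * (s ^ 3 / ε ^ 3)) ≤ 200 * ε / 100000 * K := by gcongr
    have h8 : 0 < ε * K := by positivity
    linarith
  have e3 : 12 * t * η / α = 12 * (t * η / α) := by ring
  rw [e3]
  linarith

theorem convex_rate {s t Δ ε d α β η : ℝ} {K : ℕ} (hs : 0 < s) (ht : 0 < t) (hΔ : 0 ≤ Δ)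
    (hε : 0 < ε) (hd : 0 < d)
    (hα : α = min 1 (1 / 100 * (ε ^ 2 / (s ^ 2 * d ^ 2))))
    (hβ : β = min α (1 / 100 * (ε * α / (t * d ^ 2)))) (hη : η = β * d)
    (hK : 2000000 * (max 1 (max (t * d ^ 2 / ε) (max (s ^ 2 * d ^ 2 / ε ^ 2)
      (s ^ 2 * t * d ^ 4 / ε ^ 3))) * (1 + Real.log (1 + Δ / ε + s * d / ε))) ≤ (K : ℝ)) :
    (1 - β / 2) ^ K * (Δ + 4 * d * s) + 2 * d * (6 * t * η / α + s * √α + t * η) ≤ ε := by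
  have hα0 : 0 < α := by rw [hα]; positivity
  have hα1 : α ≤ 1 := hα ▸ min_le_left _ _
  have hβ0 : 0 < β := by rw [hβ]; positivity
  have hβα : β ≤ α := hβ ▸ min_le_left _ _
  have hη0 : 0 < η := by rw [hη]; positivity
  set M := max 1 (max (t * d ^ 2 / ε) (max (s ^ 2 * d ^ 2 / ε ^ 2) (s ^ 2 * t * d ^ 4 / ε ^ 3)))
    with hM
  have hle : (1 ≤ M ∧ t * d ^ 2 / ε ≤ M) ∧ s ^ 2 * d ^ 2 / ε ^ 2 ≤ M ∧
      s ^ 2 * t * d ^ 4 / ε ^ 3 ≤ M := by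
    have h := le_refl M
    conv at h => lhs; rw [hM]
    simp only [max_le_iff] at h
    tauto
  obtain ⟨⟨m1, m2⟩, m3, m4⟩ := hle
  set w := 1 + Δ / ε + s * d / ε with hw
  have hw1 : 1 ≤ w := by
    have : 0 ≤ Δ / ε := by positivity
    have : 0 ≤ s * d / ε := by positivity
    linarith
  have hlog := Real.log_nonneg hw1
  have hinvα : 1 / α ≤ 1 + 100 * (s ^ 2 * d ^ 2) / ε ^ 2 := by
    rw [hα]
    refine (one_div_min_le one_pos (by positivity)).trans (le_of_eq ?_)
    field_simp
  -- Expanding `(1 + 100 a)(1 + 100 c)` gives four entries of the maximum with weights `1 + 100 +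
  -- 100 + 10000`.
  have hinvβ : 1 / β ≤ 10201 * M := by
    have h1 : 1 / β ≤ 1 / α * (1 + 100 * (t * d ^ 2) / ε) := by
      rw [hβ]
      refine (one_div_min_le hα0 (by positivity)).trans (le_of_eq ?_)
      field_simp
    have h2 : 1 / α * (1 + 100 * (t * d ^ 2) / ε) ≤
        (1 + 100 * (s ^ 2 * d ^ 2) / ε ^ 2) * (1 + 100 * (t * d ^ 2) / ε) := by gcongr
    have h3 : (1 + 100 * (s ^ 2 * d ^ 2) / ε ^ 2) * (1 + 100 * (t * d ^ 2) / ε) =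
        1 + 100 * (t * d ^ 2 / ε) + 100 * (s ^ 2 * d ^ 2 / ε ^ 2) +
          10000 * (s ^ 2 * t * d ^ 4 / ε ^ 3) := by
      field_simp
      ring
    linarith
  have hβM : 1 ≤ β * (10201 * M) := by
    rwa [div_le_iff₀ hβ0, mul_comm] at hinvβ
  -- The constant 2000000 is ample: `1000000 / 10201 > 10`. The additive 10 will supply the factor
  -- 11 through `exp 10 ≥ 11`.
  have hβK : 10 + Real.log w ≤ β / 2 * K := by
    have h1 : β / 2 * (2000000 * (M * (1 + Real.log w))) ≤ β / 2 * K := by gcongr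
    have h2 : 1 * (1 + Real.log w) ≤ β * (10201 * M) * (1 + Real.log w) := by gcongr
    linarith
  have hpow : (1 - β / 2) ^ K ≤ 1 / (11 * w) := by
    have h1 : (1 - β / 2) ^ K ≤ Real.exp (-(β / 2 * K)) := by
      calc (1 - β / 2) ^ K ≤ Real.exp (-(β / 2)) ^ K := by
            refine pow_le_pow_left₀ (by linarith) ?_ K
            have := Real.add_one_le_exp (-(β / 2))
            linarith
        _ = Real.exp (-(β / 2 * K)) := by
            rw [← Real.exp_nat_mul]; congr 1; ring
    have h2 : 11 * w ≤ Real.exp (β / 2 * K) := by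
      calc 11 * w ≤ Real.exp 10 * Real.exp (Real.log w) := by
            rw [Real.exp_log (by linarith)]
            have := Real.add_one_le_exp (10 : ℝ)
            gcongr
            linarith
        _ = Real.exp (10 + Real.log w) := (Real.exp_add _ _).symm
        _ ≤ _ := Real.exp_le_exp.2 hβK
    rw [Real.exp_neg, ← one_div] at h1
    exact h1.trans (one_div_le_one_div_of_le (by positivity) h2)
  have e1 : (1 - β / 2) ^ K * (Δ + 4 * d * s) ≤ 4 / 11 * ε := by
    have h1 : Δ + 4 * d * s ≤ 4 * ε * w := by
      have : 4 * ε * w = 4 * ε + 4 * Δ + 4 * (s * d) := by rw [hw]; field_simp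
      linarith
    calc _ ≤ 1 / (11 * w) * (4 * ε * w) := by gcongr
      _ = 4 / 11 * ε := by field_simp
  have hsq : s * √α ≤ ε / (10 * d) := by
    refine mul_sqrt_le hs (by positivity) ((hα ▸ min_le_right _ _ : α ≤ _).trans (le_of_eq ?_))
    field_simp
    norm_num
  have hte : t * η / α ≤ ε / (100 * d) := by
    rw [div_le_iff₀ hα0, hη]
    calc t * (β * d) ≤ t * (1 / 100 * (ε * α / (t * d ^ 2)) * d) := by
          gcongr
          exact hβ ▸ min_le_right _ _
      _ = ε / (100 * d) * α := by field_simp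
  have hte2 : t * η ≤ t * η / α := by
    rw [le_div_iff₀ hα0]
    exact mul_le_of_le_one_right (by positivity) hα1
  have e2 : 2 * d * (6 * t * η / α + s * √α + t * η) ≤ 34 / 100 * ε := by
    have h1 : 6 * t * η / α = 6 * (t * η / α) := by ring
    calc 2 * d * (6 * t * η / α + s * √α + t * η) ≤
          2 * d * (7 * (ε / (100 * d)) + ε / (10 * d)) := by
            refine mul_le_mul_of_nonneg_left ?_ (by positivity)
            rw [h1]
            linarith
      _ = 34 / 100 * ε := by field_simp; norm_num
  linarith

theorem optValue_of_subsingleton [Subsingleton X] {H : Submodule ℝ (X →L[ℝ] X)} {D : ℝ≥0∞}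
    (f : X → ℝ) {x₀ : X} (hx₀ : x₀ ∈ ballQ H D) (x : X) : f x - optValue H D f = 0 := by
  have h : f '' ballQ H D = {f x} := by
    ext c
    constructor
    · rintro ⟨y, -, rfl⟩
      rw [Subsingleton.elim y x]; rfl
    · rintro rfl
      exact ⟨x₀, hx₀, by rw [Subsingleton.elim x₀ x]⟩
  rw [optValue, h, csInf_singleton, sub_self]

end NonEuclideanSGD

end

open NonEuclideanSGD in
theorem mainTheorem1 :
    ∃ a₁ > (0 : ℝ), ∃ b₁ > (0 : ℝ), ∃ C₁ > (0 : ℝ),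
    ∃ a₂ > (0 : ℝ), ∃ b₂ > (0 : ℝ), ∃ C₂ > (0 : ℝ),
    ∀ (X : Type*) [NormedAddCommGroup X] [InnerProductSpace ℝ X] [FiniteDimensional ℝ X]
      [CompleteSpace X] [MeasurableSpace X] [BorelSpace X]
      (Ξ : Type*) [MeasurableSpace Ξ] (μ : Measure Ξ) [IsProbabilityMeasure μ]
      (Ω : Type*) [mΩ : MeasurableSpace Ω] (P : Measure Ω) [IsProbabilityMeasure P]
      (ℱ : Filtration ℕ mΩ) (ξ : ℕ → Ω → Ξ) (x m : ℕ → Ω → X)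
      (H : Submodule ℝ (X →L[ℝ] X)) (L S : X →L[ℝ] X)
      (f : X → ℝ) (g : X → Ξ → X) (D : ℝ≥0∞) (x₀ : X) (ε : ℝ),
      IsStructured H → L ∈ H → PosDef L → S ∈ H → PosDef S →
      IsWeightedSmooth f L → IsGradientOracle f g μ S →
      0 < D → (D = ⊤ → BddBelow (Set.range f)) → x₀ ∈ ballQ H D → 0 < ε →
      -- the non-convex case
      (∀ (α β η : ℝ) (K : ℕ),
        α = min 1 (a₁ * (ε ^ 2 / opTrace S ^ 2)) →
        (D ≠ ⊤ → β = min 1 (b₁ * (ε * α / (opTrace L * D.toReal))) ∧ η = β * D.toReal) →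
        (D = ⊤ → β = 0 ∧ η = b₁ * (ε * α / opTrace L)) →
        C₁ * max 1 (max ((f x₀ - optValue H D f) / ε * (D⁻¹).toReal)
          (max (opTrace L * (f x₀ - optValue H D f) / ε ^ 2)
          (max (opTrace S ^ 3 / ε ^ 3)
            (opTrace S ^ 2 * opTrace L * (f x₀ - optValue H D f) / ε ^ 4)))) ≤ (K : ℝ) →
        IsRun H g μ x₀ α β η K P ℱ ξ x m →
        Integrable (fun ω => ⨅ k : Fin K, gap H D f (x k ω)) P ∧
          ∫ ω, (⨅ k : Fin K, gap H D f (x k ω)) ∂P ≤ ε) ∧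
      -- the convex case
      (ConvexOn ℝ Set.univ f → D ≠ ⊤ → ∀ (α β η : ℝ) (K : ℕ),
        α = min 1 (a₂ * (ε ^ 2 / (opTrace S ^ 2 * D.toReal ^ 2))) →
        β = min α (b₂ * (ε * α / (opTrace L * D.toReal ^ 2))) →
        η = β * D.toReal →
        C₂ * (max 1 (max (opTrace L * D.toReal ^ 2 / ε)
          (max (opTrace S ^ 2 * D.toReal ^ 2 / ε ^ 2)
            (opTrace S ^ 2 * opTrace L * D.toReal ^ 4 / ε ^ 3))) *
          (1 + Real.log (1 + (f x₀ - optValue H D f) / ε + opTrace S * D.toReal / ε)))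
            ≤ (K : ℝ) →
        IsRun H g μ x₀ α β η K P ℱ ξ x m →
        Integrable (fun ω => f (x K ω) - optValue H D f) P ∧
          ∫ ω, (f (x K ω) - optValue H D f) ∂P ≤ ε) := by
  refine ⟨1 / 100, by norm_num, 1 / 100, by norm_num, 100000, by norm_num, 1 / 100, by norm_num,
    1 / 100, by norm_num, 2000000, by norm_num, ?_⟩
  intro X _ _ _ _ _ _ Ξ _ μ _ Ω mΩ P _ ℱ ξ x m H L S f g D x₀ ε hH hL hLp hSH hS hf hg hD hb
    hx₀ hε
  have hΔ : 0 ≤ f x₀ - optValue H D f := sub_nonneg.2 (hH.optValue_le hf hb hx₀)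
  -- On the zero space both traces vanish and the parameters divide by zero, but gap and
  -- suboptimality are zero too.
  rcases subsingleton_or_nontrivial X with hX | hX
  · refine ⟨fun α β η K _ _ _ _ _ => ?_, fun _ _ α β η K _ _ _ _ _ => ?_⟩
    · have h : ∀ y, gap H D f y = 0 := fun y => by
        rw [hH.gap_eq hD, Subsingleton.elim (∇ f y) 0, inner_zero_left, hH.normRdual_zero]
        simp
      simp [h, hε.le]
    · simp [optValue_of_subsingleton f hx₀, hε.le]
  have hs := hS.opTrace_pos
  have ht := hLp.opTrace_pos
  refine ⟨fun α β η K hα hfin hinf hK hrun => ?_, fun hconv hD' α β η K hα hβ hη hK hrun => ?_⟩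
  · have hα0 : 0 < α := by rw [hα]; positivity
    have hα1 : α ≤ 1 := hα ▸ min_le_left _ _
    have hpar : 0 < η ∧ β = η * (D⁻¹).toReal ∧ β ≤ 1 ∧
        1 / η ≤ (D⁻¹).toReal + 100 * opTrace L / (ε * α) ∧
        η ≤ 1 / 100 * (ε * α / opTrace L) := by
      rcases eq_or_ne D ⊤ with rfl | hD'
      · obtain ⟨rfl, rfl⟩ := hinf rfl
        refine ⟨by positivity, by simp, zero_le_one, le_of_eq ?_, le_rfl⟩
        simp only [ENNReal.inv_top, ENNReal.toReal_zero]
        field_simp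
        simp
      · obtain ⟨hβ, hη⟩ := hfin hD'
        have hd : 0 < D.toReal := ENNReal.toReal_pos hD.ne' hD'
        -- Multiplying the cap on `β` by `D` shows that `η` is the step for the unbounded domain,
        -- truncated at `D`.
        have hη' : η = min D.toReal (1 / 100 * (ε * α / opTrace L)) := by
          rw [hη, hβ, min_mul_of_nonneg _ _ hd.le, one_mul]
          congr 1
          field_simp
        refine ⟨by rw [hη']; positivity, ?_, hβ ▸ min_le_left _ _, ?_, hη' ▸ min_le_right _ _⟩
        · rw [hη, ENNReal.toReal_inv]; field_simp
        · rw [hη', ENNReal.toReal_inv]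
          refine (one_div_min_le hd (by positivity)).trans (le_of_eq ?_)
          field_simp
    obtain ⟨hη, hβη, hβ1, hη1, hη2⟩ := hpar
    have hK0 : 0 < K := by
      have h1 := le_max_left 1 (max ((f x₀ - optValue H D f) / ε * (D⁻¹).toReal)
          (max (opTrace L * (f x₀ - optValue H D f) / ε ^ 2)
          (max (opTrace S ^ 3 / ε ^ 3)
            (opTrace S ^ 2 * opTrace L * (f x₀ - optValue H D f) / ε ^ 4))))
      have h2 : (0 : ℝ) < K := by linarith
      exact_mod_cast h2
    obtain ⟨h1, h2⟩ := hrun.integral_iInf_gap_le hH hL hLp hSH hS hf hg hb hα0 hα1 hη hβη hβ1 hD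
      hx₀ hK0
    exact ⟨h1, h2.trans (nonconvex_rate hs ht hΔ hε hα hη hη1 hη2 hK)⟩
  · have hd : 0 < D.toReal := ENNReal.toReal_pos hD.ne' hD'
    have hα0 : 0 < α := by rw [hα]; positivity
    have hβ0 : 0 < β := by rw [hβ]; positivity
    obtain ⟨h1, h2⟩ := hrun.integral_sub_optValue_le hH hL hLp hSH hS hf hconv hg hα0
      (hα ▸ min_le_left _ _) hβ0.le (hβ ▸ min_le_left _ _) hη hD hD' hx₀ le_rfl
    exact ⟨h1, h2.trans (convex_rate hs ht hΔ hε hd hα hβ hη hK)⟩
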